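/- Let $0<\beta<1$ and let $r<0$ be real. For a function $u$ that is continuous on $[0,\infty)$ and continuously differentiable on $(0,\infty)$, and such that $\tau\mapsto (t-\tau)^{-\beta}u'(\tau)$ is integrable on $(0,t)$ for every $t>0$, let $$D^{\beta}u(t)=\frac{1}{\Gamma(1-\beta)}\int_0^t (t-\tau)^{-\beta}u'(\tau)\,d\tau ,\qquad t>0,$$ be its Caputo derivative of order $\beta$, and let $E_\beta(z)=\sum_{k=0}^{\infty} z^k/\Gamma(k\beta+1)$ be the Mittag-Leffler function. Then the initial value problem $$D^{\beta}u(t)-r\,u(t)=0\quad (t>0),\qquad u(0)=1,$$ has exactly one solution $u:[0,\infty)\to\mathbb{R}$ in this class, namely $u(t)=E_\beta(rt^\beta)$; it satisfies $$\lim_{t\to\infty}\frac{t\,u'(t)}{u(t)}=-\beta,\qquad\text{that is,}\qquad \beta=-\lim_{t\to\infty}\frac{t\,u'(t)}{u(t)} ;$$ and $E_\beta(-x)\sim \dfrac{x^{-1}}{\Gamma(1-\beta)}$ as $x\to+\infty$. -/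

import Mathlib

open Filter Topology Set MeasureTheory
open scoped Asymptotics

/-- The one-parameter Mittag-Leffler function `E_α(x) = ∑_{k ≥ 0} x ^ k / Γ(k α + 1)` at real
arguments (`α > 0`; the series then converges for every `x`). -/
noncomputable def mittagLeffler (α x : ℝ) : ℝ :=
  ∑' k : ℕ, x ^ k / Real.Gamma (k * α + 1)

/-- The Caputo fractional derivative of order `β ∈ (0, 1)` with lower terminal `0`,
`(1 / Γ(1 - β)) ∫₀ᵗ (t - τ) ^ (-β) u'(τ) dτ`, at `t > 0`. -/
noncomputable def caputoDeriv (β : ℝ) (u : ℝ → ℝ) (t : ℝ) : ℝ :=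
  1 / Real.Gamma (1 - β) * ∫ τ in (0 : ℝ)..t, (t - τ) ^ (-β) * deriv u τ

/-- `u` solves `D^β u - r u = 0` on `(0, ∞)` (Caputo derivative of order `β ∈ (0, 1)`) with
`u 0 = 1`. The integrability field says that the integral defining the Caputo derivative exists.
Values of `u` at negative arguments are irrelevant. -/
structure IsCaputoSolution (β r : ℝ) (u : ℝ → ℝ) : Prop where
  continuousOn : ContinuousOn u (Ici 0)
  contDiffOn : ContDiffOn ℝ 1 u (Ioi 0)
  integrable : ∀ t : ℝ, 0 < t →
    IntervalIntegrable (fun τ => (t - τ) ^ (-β) * deriv u τ) volume 0 t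
  equation : ∀ t : ℝ, 0 < t → caputoDeriv β u t - r * u t = 0
  initial : u 0 = 1

/-! Existence is termwise: the Beta integral turns `(t-τ)^(-β) τ^((k+1)β-1)` into a multiple of
`t^(kβ)`, so the Caputo derivative shifts the series of `E_β(r t^β)` by one index and produces the
factor `r`. For uniqueness, fractional integration of order `β` gives the Volterra equation `u = 1 +
r/Γ(β) ∫ (t-τ)^(β-1) u`; the corresponding homogeneous operator is a contraction in an exponentially
weighted sup norm.

The asymptotics come from a spectral representation (`mittagLeffler_neg_rpow`): `E_β(-t^β)` is the
Laplace transform of an explicit density, equivalent to `s^(β-1) sin(πβ)/π` at `0`. Up to a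
constant, this density is the jump across the negative axis of `p^(β-1)/(p^β+1)`, the Laplace
transform of `E_β(-t^β)`. Cauchy's theorem recovers that function as the Stieltjes transform of the
density (`integral_spectralDensity_div`), hence as its iterated Laplace transform, and injectivity
(`eq_zero_of_laplace_eq_zero`) concludes.

Watson's lemma (`tendsto_rpow_mul_laplace`) then gives `t^β E_β(-t^β) → Γ(β) sin(πβ)/π`, which is
`1/Γ(1-β)` by reflection. For the derivative it gives the same constant with `-Γ(β+1)` in place of
`Γ(β)`, so the logarithmic derivative tends to `-β`. Rescaling `t` covers every `r < 0`. -/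

section

variable {β : ℝ}

/-! ### Beta integrals; growth and smoothness of the Mittag-Leffler function -/

/-- The Beta integral on `[0, t]`. -/
theorem integral_rpow_mul_sub_rpow {a b t : ℝ} (ha : 0 < a) (hb : 0 < b) (ht : 0 < t) :
    ∫ x in (0 : ℝ)..t, x ^ (a - 1) * (t - x) ^ (b - 1) =
      t ^ (a + b - 1) * (Real.Gamma a * Real.Gamma b / Real.Gamma (a + b)) := by
  have h := Complex.betaIntegral_scaled (a : ℂ) (b : ℂ) ht
  rw [Complex.betaIntegral_eq_Gamma_mul_div _ _ (by simpa) (by simpa), ← Complex.ofReal_add,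
    Complex.Gamma_ofReal, Complex.Gamma_ofReal, Complex.Gamma_ofReal] at h
  rw [← Complex.ofReal_inj, ← intervalIntegral.integral_ofReal]
  push_cast [Complex.ofReal_cpow ht.le]
  push_cast at h
  rw [← h, intervalIntegral.integral_of_le ht.le, intervalIntegral.integral_of_le ht.le]
  refine setIntegral_congr_fun measurableSet_Ioc fun x hx => ?_
  rw [Complex.ofReal_cpow hx.1.le, Complex.ofReal_cpow (sub_nonneg.2 hx.2)]
  push_cast
  rfl

theorem intervalIntegrable_rpow_mul_sub_rpow {a b t : ℝ} (ha : 0 < a) (hb : 0 < b) (ht : 0 < t) :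
    IntervalIntegrable (fun x => x ^ (a - 1) * (t - x) ^ (b - 1)) volume 0 t := by
  -- The integral of a non-integrable function is `0` by convention, so a nonzero value proves
  -- integrability.
  apply intervalIntegral.intervalIntegrable_of_integral_ne_zero
  rw [integral_rpow_mul_sub_rpow ha hb ht]
  have := Real.Gamma_pos_of_pos ha
  have := Real.Gamma_pos_of_pos hb
  have := Real.Gamma_pos_of_pos (add_pos ha hb)
  positivity

/-- Restrict the Gamma integral to `(y, ∞)` and replace `x^a` there by `y^a`. This stands in for
Stirling's formula. -/
theorem rpow_mul_exp_neg_le_Gamma {a y : ℝ} (ha : 0 ≤ a) (hy : 0 ≤ y) :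
    y ^ a * Real.exp (-y) ≤ Real.Gamma (a + 1) := by
  have hint := Real.GammaIntegral_convergent (s := a + 1) (by linarith)
  rw [Real.Gamma_eq_integral (by linarith), ← integral_exp_neg_Ioi, ← integral_const_mul]
  calc ∫ x in Ioi y, y ^ a * Real.exp (-x)
      ≤ ∫ x in Ioi y, Real.exp (-x) * x ^ (a + 1 - 1) := by
        refine setIntegral_mono_on ((integrableOn_exp_neg_Ioi y).const_mul _)
          (hint.mono_set (Ioi_subset_Ioi hy)) measurableSet_Ioi fun x hx => ?_
        rw [add_sub_cancel_right, mul_comm]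
        gcongr
        exact (mem_Ioi.1 hx).le
    _ ≤ ∫ x in Ioi 0, Real.exp (-x) * x ^ (a + 1 - 1) := by
        refine setIntegral_mono_set hint ?_ (Ioi_subset_Ioi hy).eventuallyLE
        filter_upwards [self_mem_ae_restrict measurableSet_Ioi] with x hx
        have : (0 : ℝ) < x := hx
        positivity

/-- The choice `y = (2|x|)^(1/β)` gives `y^(kβ) = (2|x|)^k`. The bound yields both convergence and,
at `x = r t^β`, exponential type in `t`. -/
theorem abs_pow_div_Gamma_le (hβ : 0 < β) (x : ℝ) (k : ℕ) :
    |x ^ k / Real.Gamma (k * β + 1)| ≤ Real.exp ((2 * |x|) ^ β⁻¹) * (1 / 2) ^ k := by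
  have hG : 0 < Real.Gamma (k * β + 1) := Real.Gamma_pos_of_pos (by positivity)
  have h := rpow_mul_exp_neg_le_Gamma (a := k * β) (y := (2 * |x|) ^ β⁻¹) (by positivity)
    (by positivity)
  rw [← Real.rpow_mul (by positivity), mul_comm (k : ℝ), inv_mul_cancel_left₀ hβ.ne',
    Real.rpow_natCast, Real.exp_neg, ← div_eq_mul_inv, div_le_iff₀ (Real.exp_pos _), mul_comm β] at h
  rw [abs_div, abs_pow, abs_of_pos hG, div_le_iff₀ hG]
  have : |x| ^ k = (2 * |x|) ^ k * (1 / 2) ^ k := by rw [← mul_pow]; congr 1; ring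
  rw [this]
  nlinarith [show (0 : ℝ) < (1 / 2) ^ k by positivity]

theorem summable_mittagLeffler (hβ : 0 < β) (x : ℝ) :
    Summable fun k : ℕ => x ^ k / Real.Gamma (k * β + 1) :=
  .of_norm_bounded ((summable_geometric_of_lt_one (by norm_num) (by norm_num)).mul_left _)
    (abs_pow_div_Gamma_le hβ x)

theorem abs_mittagLeffler_le (hβ : 0 < β) (x : ℝ) :
    |mittagLeffler β x| ≤ 2 * Real.exp ((2 * |x|) ^ β⁻¹) := by
  have h := (hasSum_geometric_of_lt_one (r := (1 / 2 : ℝ)) (by norm_num) (by norm_num)).mul_left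
    (Real.exp ((2 * |x|) ^ β⁻¹))
  have := tsum_of_norm_bounded h fun k =>
    (Real.norm_eq_abs _).trans_le (abs_pow_div_Gamma_le hβ x k)
  rw [Real.norm_eq_abs] at this
  calc _ ≤ _ := this
    _ = _ := by ring

theorem mittagLeffler_zero : mittagLeffler β 0 = 1 := by
  rw [mittagLeffler, tsum_eq_single 0 fun k hk => by simp [hk]]
  simp

theorem contDiff_mittagLeffler (hβ : 0 < β) : ContDiff ℝ 1 (mittagLeffler β) := by
  let c : ℕ → ℝ := fun k => 1 / Real.Gamma (k * β + 1)
  let p := FormalMultilinearSeries.ofScalars ℝ c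
  have hr : p.radius = ⊤ := by
    refine p.radius_eq_top_of_summable_norm fun r => ?_
    refine (summable_mittagLeffler hβ r).congr fun k => ?_
    have hG : 0 < Real.Gamma (k * β + 1) := Real.Gamma_pos_of_pos (by positivity)
    simp only [p, FormalMultilinearSeries.ofScalars_norm, c]
    rw [Real.norm_of_nonneg (by positivity)]
    ring
  have h := p.hasFPowerSeriesOnBall (by simp [hr])
  have hE : p.sum = mittagLeffler β := by
    ext x
    rw [show p.sum x = FormalMultilinearSeries.ofScalarsSum c x from rfl,
      FormalMultilinearSeries.ofScalarsSum_eq_tsum, mittagLeffler]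
    refine tsum_congr fun k => ?_
    simp only [c, smul_eq_mul]
    ring
  rw [hE, hr] at h
  have := h.analyticOnNhd
  rw [Metric.eball_top_eq_univ] at this
  exact this.contDiff

theorem summable_deriv_mittagLeffler (hβ : 0 < β) (x : ℝ) :
    Summable fun k : ℕ => k * |x| ^ (k - 1) / Real.Gamma (k * β + 1) := by
  have h0 : Summable fun k : ℕ => (k : ℝ) ^ 1 * (1 / 2 : ℝ) ^ k :=
    summable_pow_mul_geometric_of_norm_lt_one 1 (by norm_num)
  -- Passing to `|x| + 1 ≥ 1` lets the power `k - 1` be raised to `k`, including the truncated case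
  -- `k = 0`.
  have h1 := h0.mul_left (Real.exp ((2 * (|x| + 1)) ^ β⁻¹))
  refine .of_nonneg_of_le (fun k => ?_) (fun k => ?_) h1
  · have hG : 0 < Real.Gamma (k * β + 1) := Real.Gamma_pos_of_pos (by positivity)
    positivity
  · have hG : 0 < Real.Gamma (k * β + 1) := Real.Gamma_pos_of_pos (by positivity)
    have h := abs_pow_div_Gamma_le hβ (|x| + 1) k
    rw [abs_of_nonneg (by positivity), abs_of_nonneg (a := |x| + 1) (by positivity)] at h
    calc (k : ℝ) * |x| ^ (k - 1) / Real.Gamma (k * β + 1)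
        ≤ k * (|x| + 1) ^ k / Real.Gamma (k * β + 1) := by
          gcongr
          calc |x| ^ (k - 1) ≤ (|x| + 1) ^ (k - 1) := by gcongr; linarith
            _ ≤ (|x| + 1) ^ k := pow_le_pow_right₀ (by linarith [abs_nonneg x]) (by omega)
      _ = k * ((|x| + 1) ^ k / Real.Gamma (k * β + 1)) := by ring
      _ ≤ k * (Real.exp ((2 * (|x| + 1)) ^ β⁻¹) * (1 / 2) ^ k) := by gcongr
      _ = _ := by ring

/-- Termwise differentiation; `Γ(z+1) = zΓ(z)` absorbs the factor `k + 1` and leaves the Gamma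
values that the Beta integral will cancel. -/
theorem hasDerivAt_mittagLeffler (hβ : 0 < β) (x : ℝ) :
    HasDerivAt (mittagLeffler β)
      (∑' k : ℕ, x ^ k / (β * Real.Gamma ((k + 1) * β))) x := by
  have key : HasDerivAt (fun z => ∑' k : ℕ, z ^ k / Real.Gamma (k * β + 1))
      (∑' k : ℕ, k * x ^ (k - 1) / Real.Gamma (k * β + 1)) x := by
    refine hasDerivAt_tsum_of_isPreconnected (summable_deriv_mittagLeffler hβ (|x| + 1))
      Metric.isOpen_ball (convex_ball (0 : ℝ) (|x| + 1)).isPreconnected (y₀ := 0)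
      (fun k y _ => (hasDerivAt_pow k y).div_const _) (fun k y hy => ?_) ?_
      (summable_mittagLeffler hβ 0) ?_
    · have hG : 0 < Real.Gamma (k * β + 1) := Real.Gamma_pos_of_pos (by positivity)
      rw [norm_div, norm_mul, norm_pow, Real.norm_of_nonneg hG.le, Real.norm_natCast]
      rw [mem_ball_zero_iff] at hy
      rw [abs_of_nonneg (a := |x| + 1) (by positivity)]
      gcongr
    · simp; positivity
    · simp
  have hs : Summable fun k : ℕ => k * x ^ (k - 1) / Real.Gamma (k * β + 1) := by
    refine .of_norm_bounded (summable_deriv_mittagLeffler hβ x) fun k => ?_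
    have hG : 0 < Real.Gamma (k * β + 1) := Real.Gamma_pos_of_pos (by positivity)
    rw [norm_div, norm_mul, norm_pow, Real.norm_of_nonneg hG.le, Real.norm_natCast,
      Real.norm_eq_abs]
  refine key.congr_deriv ?_
  rw [hs.tsum_eq_zero_add]
  simp only [CharP.cast_eq_zero, zero_mul, zero_div, zero_add]
  refine tsum_congr fun k => ?_
  have hk : (0 : ℝ) < (k + 1) * β := by positivity
  have hG := Real.Gamma_pos_of_pos hk
  rw [Nat.cast_succ, Real.Gamma_add_one hk.ne', Nat.add_sub_cancel]
  field_simp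

theorem hasDerivAt_mittagLeffler_rpow (hβ : 0 < β) (r : ℝ) {t : ℝ} (ht : 0 < t) :
    HasDerivAt (fun t => mittagLeffler β (r * t ^ β))
      (deriv (mittagLeffler β) (r * t ^ β) * (r * (β * t ^ (β - 1)))) t :=
  ((contDiff_mittagLeffler hβ).differentiable one_ne_zero _).hasDerivAt.comp t
    ((Real.hasDerivAt_rpow_const (Or.inl ht.ne')).const_mul r)

theorem continuous_mittagLeffler_rpow (hβ : 0 < β) (r : ℝ) :
    Continuous fun t : ℝ => mittagLeffler β (r * t ^ β) :=
  (contDiff_mittagLeffler hβ).continuous.comp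
    (continuous_const.mul (Real.continuous_rpow_const hβ.le))

/-! ### Existence: `E_β(r t^β)` solves the equation -/

/-- Sum and integral may be exchanged because the `L¹` norms of the terms form, up to a constant,
the Mittag-Leffler series at `|r| t^β`. -/
theorem integral_caputo_mittagLeffler (hβ0 : 0 < β) (hβ1 : β < 1) (r : ℝ) {t : ℝ} (ht : 0 < t) :
    ∫ τ in (0 : ℝ)..t, (t - τ) ^ (-β) * deriv (fun t => mittagLeffler β (r * t ^ β)) τ =
      Real.Gamma (1 - β) * (r * mittagLeffler β (r * t ^ β)) := by
  have hk (k : ℕ) : (0 : ℝ) < (k + 1) * β := by positivity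
  have hb : 0 < 1 - β := by linarith
  let f : ℕ → ℝ → ℝ := fun k τ =>
    r ^ (k + 1) / Real.Gamma ((k + 1) * β) * (τ ^ ((k + 1) * β - 1) * (t - τ) ^ (1 - β - 1))
  have hnn (k : ℕ) : ∀ τ ∈ Ioc 0 t, 0 ≤ τ ^ ((k + 1) * β - 1) * (t - τ) ^ (1 - β - 1) := by
    intro τ hτ
    have := hτ.1
    have : 0 ≤ t - τ := sub_nonneg.2 hτ.2
    positivity
  have hI (k : ℕ) : ∫ τ in (0 : ℝ)..t, τ ^ ((k + 1) * β - 1) * (t - τ) ^ (1 - β - 1) =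
      Real.Gamma ((k + 1) * β) * (Real.Gamma (1 - β) * ((t ^ β) ^ k / Real.Gamma (k * β + 1))) := by
    rw [integral_rpow_mul_sub_rpow (hk k) hb ht, ← Real.rpow_mul_natCast ht.le,
      show ((k + 1) * β + (1 - β) : ℝ) = k * β + 1 by ring, add_sub_cancel_right, mul_comm β]
    ring
  have hint (k : ℕ) : Integrable (f k) (volume.restrict (Ioc 0 t)) :=
    (((intervalIntegrable_iff_integrableOn_Ioc_of_le ht.le).1
      (intervalIntegrable_rpow_mul_sub_rpow (hk k) hb ht)).const_mul _)
  have hnorm (k : ℕ) : ∫ τ in Ioc 0 t, ‖f k τ‖ =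
      |r| * Real.Gamma (1 - β) * ((|r| * t ^ β) ^ k / Real.Gamma (k * β + 1)) := by
    have hG := Real.Gamma_pos_of_pos (hk k)
    rw [show ∫ τ in Ioc 0 t, ‖f k τ‖ = ∫ τ in Ioc 0 t, |r| ^ (k + 1) / Real.Gamma ((k + 1) * β) *
      (τ ^ ((k + 1) * β - 1) * (t - τ) ^ (1 - β - 1)) from
        setIntegral_congr_fun measurableSet_Ioc fun τ hτ => ?_, integral_const_mul,
      ← intervalIntegral.integral_of_le ht.le, hI, mul_pow, pow_succ]
    · field_simp
    · simp only [f]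
      rw [norm_mul, Real.norm_of_nonneg (hnn k τ hτ), norm_div, Real.norm_of_nonneg hG.le,
        norm_pow, Real.norm_eq_abs]
  have hsum := hasSum_integral_of_summable_integral_norm hint (by
    simp_rw [hnorm]
    exact (summable_mittagLeffler hβ0 _).mul_left _)
  have hval (k : ℕ) : ∫ τ in Ioc 0 t, f k τ =
      r * Real.Gamma (1 - β) * ((r * t ^ β) ^ k / Real.Gamma (k * β + 1)) := by
    have hG := Real.Gamma_pos_of_pos (hk k)
    simp only [f]
    rw [integral_const_mul, ← intervalIntegral.integral_of_le ht.le, hI, mul_pow, pow_succ]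
    field_simp
  simp_rw [hval] at hsum
  have h2 := (summable_mittagLeffler hβ0 (r * t ^ β)).hasSum.mul_left (r * Real.Gamma (1 - β))
  rw [intervalIntegral.integral_of_le ht.le]
  have h3 := hsum.unique h2
  change _ = r * Real.Gamma (1 - β) * mittagLeffler β (r * t ^ β) at h3
  rw [← mul_assoc, mul_comm (Real.Gamma _), ← h3]
  refine setIntegral_congr_fun measurableSet_Ioc fun τ hτ => ?_
  simp only [f]
  rw [(hasDerivAt_mittagLeffler_rpow hβ0 r hτ.1).deriv, (hasDerivAt_mittagLeffler hβ0 _).deriv,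
    ← tsum_mul_right, ← tsum_mul_left]
  refine tsum_congr fun k => ?_
  have hG := Real.Gamma_pos_of_pos (hk k)
  rw [show ((k + 1) * β - 1 : ℝ) = β * k + (β - 1) by ring, Real.rpow_add hτ.1,
    Real.rpow_mul_natCast hτ.1.le, show 1 - β - 1 = -β by ring, mul_pow, pow_succ]
  field_simp

theorem isCaputoSolution_mittagLeffler (hβ0 : 0 < β) (hβ1 : β < 1) (r : ℝ) :
    IsCaputoSolution β r (fun t => mittagLeffler β (r * t ^ β)) where
  continuousOn := (continuous_mittagLeffler_rpow hβ0 r).continuousOn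
  contDiffOn := fun t ht => ((contDiff_mittagLeffler hβ0).contDiffAt.comp t
    (contDiffAt_const.mul (Real.contDiffAt_rpow_const_of_ne (ne_of_gt ht)))).contDiffWithinAt
  integrable := fun t ht => by
    have h := (intervalIntegrable_rpow_mul_sub_rpow hβ0 (sub_pos.2 hβ1) ht).mul_continuousOn
      (g := fun τ => r * β * deriv (mittagLeffler β) (r * τ ^ β))
      (continuous_const.mul (((contDiff_mittagLeffler hβ0).continuous_deriv le_rfl).comp
        (continuous_const.mul (Real.continuous_rpow_const hβ0.le)))).continuousOn
    refine h.congr fun τ hτ => ?_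
    rw [uIoc_of_le ht.le] at hτ
    rw [(hasDerivAt_mittagLeffler_rpow hβ0 r hτ.1).deriv, show 1 - β - 1 = -β by ring]
    ring
  equation := fun t ht => by
    have hG := Real.Gamma_pos_of_pos (sub_pos.2 hβ1)
    rw [caputoDeriv, integral_caputo_mittagLeffler hβ0 hβ1 r ht]
    field_simp
    ring
  initial := by simp [Real.zero_rpow hβ0.ne', mittagLeffler_zero]

/-! ### Uniqueness through a Volterra equation -/

theorem integral_sub_rpow_mul_sub_rpow (hβ0 : 0 < β) (hβ1 : β < 1) {s t : ℝ} (hst : s < t) :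
    ∫ τ in s..t, (t - τ) ^ (β - 1) * (τ - s) ^ (-β) = Real.Gamma β * Real.Gamma (1 - β) := by
  have h := integral_rpow_mul_sub_rpow (sub_pos.2 hβ1) hβ0 (sub_pos.2 hst)
  have h2 := intervalIntegral.integral_comp_sub_right (a := s) (b := t)
    (fun x => x ^ (1 - β - 1) * (t - s - x) ^ (β - 1)) s
  rw [sub_self, h] at h2
  simp only [sub_add_cancel, Real.Gamma_one, sub_self, Real.rpow_zero, div_one, one_mul] at h2
  rw [mul_comm (Real.Gamma β), ← h2]
  refine intervalIntegral.integral_congr fun τ _ => ?_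
  simp only [sub_sub_sub_cancel_right]
  rw [show 1 - β - 1 = -β by ring, mul_comm]

theorem intervalIntegrable_sub_rpow_mul_sub_rpow (hβ0 : 0 < β) (hβ1 : β < 1) {s t : ℝ}
    (hst : s < t) :
    IntervalIntegrable (fun τ => (t - τ) ^ (β - 1) * (τ - s) ^ (-β)) volume s t := by
  apply intervalIntegral.intervalIntegrable_of_integral_ne_zero
  rw [integral_sub_rpow_mul_sub_rpow hβ0 hβ1 hst]
  have := Real.Gamma_pos_of_pos hβ0
  have := Real.Gamma_pos_of_pos (sub_pos.2 hβ1)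
  positivity

/-- The Riemann-Liouville integrals of orders `β` and `1 - β` compose to the usual integral. -/
theorem integral_sub_rpow_mul_integral_sub_rpow_mul (hβ0 : 0 < β) (hβ1 : β < 1) {g : ℝ → ℝ} {t : ℝ}
    (ht : 0 < t) (hg : IntervalIntegrable g volume 0 t) :
    ∫ τ in (0 : ℝ)..t, (t - τ) ^ (β - 1) * ∫ s in (0 : ℝ)..τ, (τ - s) ^ (-β) * g s =
      Real.Gamma β * Real.Gamma (1 - β) * ∫ s in (0 : ℝ)..t, g s := by
  rw [intervalIntegrable_iff_integrableOn_Ioc_of_le ht.le] at hg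
  let μ : Measure ℝ := volume.restrict (Ioc 0 t)
  -- The indicator encodes the triangle `s < τ`, so that Fubini can be used on the square.
  let k : ℝ → ℝ → ℝ := fun τ s => (Ioi s).indicator (fun τ => (t - τ) ^ (β - 1) * (τ - s) ^ (-β)) τ
  -- The endpoint `s = t` must go: there the inner interval is empty and the Beta value fails.
  have hlt : ∀ᵐ s ∂μ, s ∈ Ioo 0 t := by
    rw [show μ = volume.restrict (Ioo 0 t) from (Measure.restrict_congr_set Ioo_ae_eq_Ioc).symm]
    exact ae_restrict_mem measurableSet_Ioo
  have hset {s : ℝ} (hs : s ∈ Ioo 0 t) : Ioi s ∩ Ioc 0 t = Ioc s t := by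
    ext x
    simp only [mem_inter_iff, mem_Ioi, mem_Ioc]
    exact ⟨fun h => ⟨h.1, h.2.2⟩, fun h => ⟨h.1, hs.1.trans h.1, h.2⟩⟩
  have hkI {s : ℝ} (hs : s ∈ Ioo 0 t) : ∫ τ, k τ s ∂μ = Real.Gamma β * Real.Gamma (1 - β) := by
    simp only [k]
    rw [integral_indicator measurableSet_Ioi, Measure.restrict_restrict measurableSet_Ioi, hset hs,
      ← intervalIntegral.integral_of_le hs.2.le, integral_sub_rpow_mul_sub_rpow hβ0 hβ1 hs.2]
  have hkint {s : ℝ} (hs : s ∈ Ioo 0 t) : Integrable (fun τ => k τ s) μ := by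
    simp only [k]
    rw [integrable_indicator_iff measurableSet_Ioi, IntegrableOn,
      Measure.restrict_restrict measurableSet_Ioi, hset hs]
    exact (intervalIntegrable_iff_integrableOn_Ioc_of_le hs.2.le).1
      (intervalIntegrable_sub_rpow_mul_sub_rpow hβ0 hβ1 hs.2)
  have hknn (s : ℝ) : ∀ᵐ τ ∂μ, 0 ≤ k τ s := by
    filter_upwards [ae_restrict_mem measurableSet_Ioc] with τ hτ
    refine indicator_apply_nonneg fun h => ?_
    have h1 : 0 ≤ t - τ := sub_nonneg.2 hτ.2
    have h2 : 0 ≤ τ - s := sub_nonneg.2 (mem_Ioi.1 h).le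
    positivity
  have hkm : Measurable (fun p : ℝ × ℝ => k p.1 p.2) := by
    have : (fun p : ℝ × ℝ => k p.1 p.2) = {p : ℝ × ℝ | p.2 < p.1}.indicator
        (fun p => (t - p.1) ^ (β - 1) * (p.1 - p.2) ^ (-β)) := by
      ext p
      simp only [k, indicator, mem_Ioi, mem_ofPred_eq]
    rw [this]
    exact Measurable.indicator (by fun_prop) (measurableSet_lt measurable_snd measurable_fst)
  -- Tonelli's criterion: integrating `|k τ s * g s|` in `τ` leaves the constant `Γ(β)Γ(1-β)` times
  -- `|g s|`.
  have hH : Integrable (Function.uncurry fun τ s => k τ s * g s) (μ.prod μ) := by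
    rw [integrable_prod_iff']
    · constructor
      · filter_upwards [hlt] with s hs
        exact (hkint hs).mul_const (g s)
      · refine (hg.norm.const_mul (Real.Gamma β * Real.Gamma (1 - β))).congr ?_
        filter_upwards [hlt] with s hs
        simp only [Function.uncurry, norm_mul]
        rw [integral_mul_const, ← hkI hs]
        congr 1
        refine integral_congr_ae ?_
        filter_upwards [hknn s] with τ h using (Real.norm_of_nonneg h).symm
    · exact hkm.aestronglyMeasurable.mul hg.aestronglyMeasurable.comp_snd
  have hswap := integral_integral_swap hH
  rw [intervalIntegral.integral_of_le ht.le, intervalIntegral.integral_of_le ht.le]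
  calc _ = ∫ τ, ∫ s, k τ s * g s ∂μ ∂μ := by
        refine setIntegral_congr_fun measurableSet_Ioc fun τ hτ => ?_
        have h1 : ∀ s, k τ s * g s =
            (Iio τ).indicator (fun s => (t - τ) ^ (β - 1) * ((τ - s) ^ (-β) * g s)) s := by
          intro s
          simp only [k, indicator, mem_Ioi, mem_Iio]
          split_ifs <;> ring
        have h2 : Iio τ ∩ Ioc 0 t = Ioo 0 τ := by
          ext x
          simp only [mem_inter_iff, mem_Iio, mem_Ioc, mem_Ioo]
          exact ⟨fun h => ⟨h.2.1, h.1⟩, fun h => ⟨h.2, h.1, h.2.le.trans hτ.2⟩⟩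
        simp only [h1]
        rw [integral_indicator measurableSet_Iio, Measure.restrict_restrict measurableSet_Iio, h2,
          integral_const_mul, intervalIntegral.integral_of_le hτ.1.le, integral_Ioc_eq_integral_Ioo]
    _ = ∫ s, ∫ τ, k τ s * g s ∂μ ∂μ := hswap
    _ = ∫ s, Real.Gamma β * Real.Gamma (1 - β) * g s ∂μ := by
        refine integral_congr_ae ?_
        filter_upwards [hlt] with s hs
        rw [integral_mul_const, hkI hs]
    _ = _ := integral_const_mul _ _

/-- Apply the kernel `(t-τ)^(β-1)` to both sides of the equation; the composed kernels integrate
`u'` back to `u t - u 0`. -/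
theorem IsCaputoSolution.eq_one_add_integral (hβ0 : 0 < β) (hβ1 : β < 1) {r : ℝ} {u : ℝ → ℝ}
    (hu : IsCaputoSolution β r u) {t : ℝ} (ht : 0 < t) :
    u t = 1 + r / Real.Gamma β * ∫ τ in (0 : ℝ)..t, (t - τ) ^ (β - 1) * u τ := by
  have hG := Real.Gamma_pos_of_pos (sub_pos.2 hβ1)
  have hG' := Real.Gamma_pos_of_pos hβ0
  have hint : IntervalIntegrable (deriv u) volume 0 t := by
    have h := (hu.integrable t ht).mul_continuousOn (g := fun τ => (t - τ) ^ β)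
      ((Real.continuous_rpow_const hβ0.le).comp (continuous_const.sub continuous_id)).continuousOn
    refine h.congr_ae ?_
    -- `(t-τ)^(-β) (t-τ)^β = 1` fails at `τ = t`, hence the open interval.
    rw [uIoc_of_le ht.le, ← restrict_Ioo_eq_restrict_Ioc]
    filter_upwards [ae_restrict_mem measurableSet_Ioo] with τ hτ
    have : 0 < t - τ := sub_pos.2 hτ.2
    rw [Real.rpow_neg this.le]
    field_simp
  have hftc : ∫ τ in (0 : ℝ)..t, deriv u τ = u t - u 0 :=
    intervalIntegral.integral_eq_sub_of_hasDerivAt_of_le ht.le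
      (hu.continuousOn.mono Icc_subset_Ici_self)
      (fun x hx => ((hu.contDiffOn.differentiableOn one_ne_zero).differentiableAt
        (Ioi_mem_nhds hx.1)).hasDerivAt) hint
  have h := integral_sub_rpow_mul_integral_sub_rpow_mul hβ0 hβ1 ht hint
  rw [hftc, hu.initial] at h
  have h2 : ∫ τ in (0 : ℝ)..t, (t - τ) ^ (β - 1) * ∫ s in (0 : ℝ)..τ, (τ - s) ^ (-β) * deriv u s =
      ∫ τ in (0 : ℝ)..t, Real.Gamma (1 - β) * r * ((t - τ) ^ (β - 1) * u τ) := by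
    rw [intervalIntegral.integral_of_le ht.le, intervalIntegral.integral_of_le ht.le]
    refine setIntegral_congr_fun measurableSet_Ioc fun τ hτ => ?_
    have := hu.equation τ hτ.1
    rw [caputoDeriv, sub_eq_zero, div_mul_eq_mul_div, one_mul, div_eq_iff hG.ne'] at this
    simp only [this]
    ring
  rw [h2, intervalIntegral.integral_const_mul] at h
  field_simp
  apply mul_left_cancel₀ hG.ne'
  linear_combination -h

/-- The homogeneous Volterra equation with weakly singular kernel has only the zero solution. -/
theorem eq_zero_of_eq_integral_sub_rpow_mul (hβ0 : 0 < β) {c : ℝ} {w : ℝ → ℝ}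
    (hw : ContinuousOn w (Ici 0)) (hw0 : w 0 = 0)
    (h : ∀ t, 0 < t → w t = c * ∫ τ in (0 : ℝ)..t, (t - τ) ^ (β - 1) * w τ) {T : ℝ} (hT : 0 ≤ T) :
    w T = 0 := by
  have hG := Real.Gamma_pos_of_pos hβ0
  -- With `l = q^(1/β)`, `∫ x^(β-1) e^(-lx) dx` over `(0, ∞)` equals `Γ(β)/q`, so the operator has
  -- norm at most `|c|Γ(β)/q ≤ 1/2` for the weight `e^(-lt)`. The `+ 1` keeps `q > 0` when `c = 0`.
  set q : ℝ := 2 * |c| * Real.Gamma β + 1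
  have hq : 0 < q := by positivity
  set l : ℝ := q ^ β⁻¹
  have hl : 0 < l := by positivity
  have hlq : (1 / l) ^ β = 1 / q := by
    rw [Real.div_rpow zero_le_one hl.le, Real.one_rpow, ← Real.rpow_mul hq.le,
      inv_mul_cancel₀ hβ0.ne', Real.rpow_one]
  obtain ⟨t, ht, hmax⟩ := isCompact_Icc.exists_isMaxOn (nonempty_Icc.2 hT)
    (f := fun t => Real.exp (-(l * t)) * |w t|)
    ((Continuous.continuousOn (by fun_prop)).mul (hw.mono Icc_subset_Ici_self).abs)
  set M := Real.exp (-(l * t)) * |w t|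
  have hM0 : 0 ≤ M := by positivity
  have hb : ∀ τ ∈ Icc 0 T, |w τ| ≤ M * Real.exp (l * τ) := fun τ hτ => by
    have : Real.exp (-(l * τ)) * |w τ| ≤ M := hmax hτ
    rwa [Real.exp_neg, inv_mul_le_iff₀ (Real.exp_pos _), mul_comm] at this
  suffices hM : M = 0 by
    have := hb T (right_mem_Icc.2 hT)
    rw [hM, zero_mul] at this
    exact abs_nonpos_iff.1 this
  rcases ht.1.eq_or_lt with h0 | h0
  · simp only [M, ← h0, hw0, abs_zero, mul_zero]
  have hgam : IntegrableOn (fun x : ℝ => x ^ (β - 1) * Real.exp (-(l * x))) (Ioi 0) := by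
    by_contra hn
    have := Real.integral_rpow_mul_exp_neg_mul_Ioi hβ0 hl
    rw [integral_undef hn] at this
    have : 0 < (1 / l) ^ β * Real.Gamma β := by positivity
    linarith
  have hexp : ∫ τ in (0 : ℝ)..t, (t - τ) ^ (β - 1) * Real.exp (l * τ) ≤
      Real.exp (l * t) * (Real.Gamma β / q) := by
    have h1 := intervalIntegral.integral_comp_sub_left (a := 0) (b := t)
      (fun x => x ^ (β - 1) * Real.exp (-(l * x))) t
    rw [sub_zero, sub_self] at h1
    calc _ = ∫ τ in (0 : ℝ)..t, Real.exp (l * t) *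
          ((t - τ) ^ (β - 1) * Real.exp (-(l * (t - τ)))) := by
          refine intervalIntegral.integral_congr fun τ _ => ?_
          rw [show l * τ = l * t + -(l * (t - τ)) by ring, Real.exp_add]
          ring
      _ = Real.exp (l * t) * ∫ x in Ioc 0 t, x ^ (β - 1) * Real.exp (-(l * x)) := by
          rw [intervalIntegral.integral_const_mul, h1, intervalIntegral.integral_of_le h0.le]
      _ ≤ Real.exp (l * t) * ∫ x in Ioi 0, x ^ (β - 1) * Real.exp (-(l * x)) := by
          refine mul_le_mul_of_nonneg_left ?_ (Real.exp_pos _).le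
          refine setIntegral_mono_set hgam ?_ Ioc_subset_Ioi_self.eventuallyLE
          filter_upwards [self_mem_ae_restrict measurableSet_Ioi] with x hx
          have : (0 : ℝ) < x := hx
          positivity
      _ = _ := by
          rw [Real.integral_rpow_mul_exp_neg_mul_Ioi hβ0 hl, hlq]
          ring
  have hker : IntervalIntegrable (fun τ => (t - τ) ^ (β - 1)) volume 0 t := by
    simpa using intervalIntegrable_rpow_mul_sub_rpow one_pos hβ0 h0
  have hbound : |∫ τ in (0 : ℝ)..t, (t - τ) ^ (β - 1) * w τ| ≤
      M * (Real.exp (l * t) * (Real.Gamma β / q)) := by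
    calc _ ≤ ∫ τ in (0 : ℝ)..t, M * ((t - τ) ^ (β - 1) * Real.exp (l * τ)) := by
          rw [← Real.norm_eq_abs]
          refine intervalIntegral.norm_integral_le_of_norm_le h0.le ?_
            ((hker.mul_continuousOn (g := fun τ => Real.exp (l * τ)) (Continuous.continuousOn (by fun_prop))).const_mul M)
          refine Eventually.of_forall fun τ hτ => ?_
          have h2 : 0 ≤ t - τ := sub_nonneg.2 hτ.2
          rw [norm_mul, Real.norm_of_nonneg (by positivity), Real.norm_eq_abs]
          calc _ ≤ (t - τ) ^ (β - 1) * (M * Real.exp (l * τ)) := by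
                gcongr
                exact hb τ ⟨hτ.1.le, hτ.2.trans ht.2⟩
            _ = _ := by ring
      _ ≤ _ := by
          rw [intervalIntegral.integral_const_mul]
          gcongr
  have hfin : M ≤ M * (|c| * Real.Gamma β / q) := by
    calc M = Real.exp (-(l * t)) * (|c| * |∫ τ in (0 : ℝ)..t, (t - τ) ^ (β - 1) * w τ|) := by
          rw [← abs_mul, ← h t h0]
      _ ≤ Real.exp (-(l * t)) * (|c| * (M * (Real.exp (l * t) * (Real.Gamma β / q)))) := by
          gcongr
      _ = _ := by
          rw [Real.exp_neg]
          field_simp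
  have hhalf : |c| * Real.Gamma β / q ≤ 1 / 2 := by
    rw [div_le_iff₀ hq]
    simp only [q]
    linarith
  -- `0 ≤ M ≤ M/2` forces `M = 0`.
  nlinarith

theorem IsCaputoSolution.unique (hβ0 : 0 < β) (hβ1 : β < 1) {r : ℝ} {u v : ℝ → ℝ}
    (hu : IsCaputoSolution β r u) (hv : IsCaputoSolution β r v) {t : ℝ} (ht : 0 ≤ t) :
    u t = v t := by
  rw [← sub_eq_zero]
  refine eq_zero_of_eq_integral_sub_rpow_mul hβ0 (w := fun t => u t - v t)
    (c := r / Real.Gamma β) (hu.continuousOn.sub hv.continuousOn)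
    (by simp [hu.initial, hv.initial]) (fun s hs => ?_) ht
  have hker : IntervalIntegrable (fun τ => (s - τ) ^ (β - 1)) volume 0 s := by
    simpa using intervalIntegrable_rpow_mul_sub_rpow one_pos hβ0 hs
  have hsub : uIcc 0 s ⊆ Ici 0 := by
    rw [uIcc_of_le hs.le]
    exact Icc_subset_Ici_self
  simp only [mul_sub]
  rw [intervalIntegral.integral_sub (hker.mul_continuousOn (hu.continuousOn.mono hsub))
    (hker.mul_continuousOn (hv.continuousOn.mono hsub)), hu.eq_one_add_integral hβ0 hβ1 hs,
    hv.eq_one_add_integral hβ0 hβ1 hs]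
  ring

/-! ### Injectivity of the Laplace transform and Watson's lemma -/

theorem integrableOn_exp_neg_mul_mul {w : ℝ → ℝ} {A a p : ℝ} (hw : ContinuousOn w (Ici 0))
    (hb : ∀ t, 0 ≤ t → |w t| ≤ A * Real.exp (a * t)) (hp : a < p) :
    IntegrableOn (fun t => Real.exp (-(p * t)) * w t) (Ioi 0) := by
  refine ((exp_neg_integrableOn_Ioi 0 (sub_pos.2 hp)).const_mul A).mono' ?_ ?_
  · exact ((Continuous.continuousOn (by fun_prop)).mul
      (hw.mono Ioi_subset_Ici_self)).aestronglyMeasurable measurableSet_Ioi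
  · filter_upwards [ae_restrict_mem measurableSet_Ioi] with t ht
    rw [norm_mul, Real.norm_of_nonneg (Real.exp_pos _).le, Real.norm_eq_abs]
    calc _ ≤ Real.exp (-(p * t)) * (A * Real.exp (a * t)) := by
          gcongr
          exact hb t (le_of_lt ht)
      _ = A * (Real.exp (-(p * t)) * Real.exp (a * t)) := by ring
      _ = _ := by
          rw [← Real.exp_add]
          ring_nf

/-- A continuous function of exponential type whose Laplace transform vanishes near `+∞` is `0`. -/
theorem eq_zero_of_laplace_eq_zero {w : ℝ → ℝ} {A a p₀ : ℝ} (hw : ContinuousOn w (Ici 0))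
    (hb : ∀ t, 0 ≤ t → |w t| ≤ A * Real.exp (a * t))
    (h : ∀ p, p₀ < p → ∫ t in Ioi (0 : ℝ), Real.exp (-(p * t)) * w t = 0) {t : ℝ} (ht : 0 < t) :
    w t = 0 := by
  have hA : 0 ≤ A := by simpa using (abs_nonneg _).trans (hb 0 le_rfl)
  obtain ⟨m, hma, hmp⟩ : ∃ m, a + 1 ≤ m ∧ p₀ ≤ m := ⟨_, le_max_left _ _, le_max_right _ _⟩
  have hint (p : ℝ) (hp : m ≤ p) : IntegrableOn (fun t => Real.exp (-(p * t)) * w t) (Ioi 0) :=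
    integrableOn_exp_neg_mul_mul hw hb (by linarith)
  have hbm (t : ℝ) (ht : 0 ≤ t) : |Real.exp (-(m * t)) * w t| ≤ A * Real.exp (-t) := by
    rw [abs_mul, abs_of_pos (Real.exp_pos _)]
    calc _ ≤ Real.exp (-(m * t)) * (A * Real.exp (a * t)) := by
          gcongr
          exact hb t ht
      _ = A * (Real.exp (-(m * t)) * Real.exp (a * t)) := by ring
      _ = A * Real.exp (-(m * t) + a * t) := by rw [← Real.exp_add]
      _ ≤ _ := by
          gcongr
          nlinarith
  -- The substitution `x = e^(-t)` moves `e^(-mt) w t` to `[0, 1]`; since `m ≥ a + 1`, it extends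
  -- continuously by `0` at `x = 0`, and Weierstrass approximation applies.
  let φ : ℝ → ℝ := fun x => if x ≤ 0 then 0 else Real.exp (-(m * -Real.log x)) * w (-Real.log x)
  have hφexp (t : ℝ) : φ (Real.exp (-t)) = Real.exp (-(m * t)) * w t := by
    simp [φ, (Real.exp_pos _).not_ge]
  have hφb (x : ℝ) (hx : x ∈ Icc 0 1) : |φ x| ≤ A * x := by
    rcases hx.1.eq_or_lt with h0 | h0
    · simp [φ, ← h0]
    · have h2 := hbm (-Real.log x) (neg_nonneg.2 (Real.log_nonpos hx.1 hx.2))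
      rw [neg_neg, Real.exp_log h0] at h2
      simpa only [φ, if_neg h0.not_ge] using h2
  have hφc : ContinuousOn φ (Icc 0 1) := by
    intro x hx
    rcases hx.1.eq_or_lt with h0 | h0
    · have hφ0 : φ x = 0 := by simp [φ, ← h0]
      rw [ContinuousWithinAt, hφ0]
      refine squeeze_zero_norm' (a := fun x => A * x) ?_ ?_
      · filter_upwards [self_mem_nhdsWithin] with y hy using hφb y hy
      · have : Tendsto (fun x => A * x) (𝓝 x) (𝓝 (A * x)) :=
          Continuous.tendsto (by fun_prop) x
        rw [← h0, mul_zero] at this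
        rw [← h0]
        exact this.mono_left nhdsWithin_le_nhds
    · have hlog : ContinuousWithinAt (fun x => -Real.log x) (Icc 0 1) x :=
        (Real.continuousAt_log h0.ne').neg.continuousWithinAt
      have hmem : -Real.log x ∈ Ici (0 : ℝ) := neg_nonneg.2 (Real.log_nonpos hx.1 hx.2)
      have hc : ContinuousWithinAt
          (fun x => Real.exp (-(m * -Real.log x)) * w (-Real.log x)) (Icc 0 1) x :=
        ((Real.continuous_exp.comp (continuous_const.mul continuous_id).neg).continuousAt
          |>.comp_continuousWithinAt hlog).mul
          (ContinuousWithinAt.comp (g := w) (f := fun x => -Real.log x) (hw _ hmem) hlog fun y hy => neg_nonneg.2 (Real.log_nonpos hy.1 hy.2))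
      refine hc.congr_of_eventuallyEq ?_ (by simp [φ, h0.not_ge])
      filter_upwards [nhdsWithin_le_nhds (Ioi_mem_nhds h0)] with y hy
      simp [φ, (mem_Ioi.1 hy).not_ge]
  -- Each monomial in `e^(-t)` gives the Laplace transform at `m + 1 + i`; the `+ 1` makes this
  -- strictly larger than `p₀`.
  have hpoly (P : Polynomial ℝ) :
      ∫ t in Ioi (0 : ℝ), P.eval (Real.exp (-t)) * (Real.exp (-((m + 1) * t)) * w t) = 0 := by
    have hmon (t : ℝ) (i : ℕ) : P.coeff i * Real.exp (-t) ^ i * (Real.exp (-((m + 1) * t)) * w t) =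
        P.coeff i * (Real.exp (-((m + 1 + i) * t)) * w t) := by
      rw [← Real.exp_nat_mul, mul_assoc, ← mul_assoc (Real.exp _), ← Real.exp_add]
      ring_nf
    simp_rw [Polynomial.eval_eq_sum_range, Finset.sum_mul, hmon]
    have hi (i : ℕ) : (0 : ℝ) ≤ i := i.cast_nonneg
    rw [integral_finsetSum _ fun i _ => (hint _ (by linarith [hi i])).const_mul _]
    refine Finset.sum_eq_zero fun i _ => ?_
    rw [integral_const_mul, h _ (by linarith [hi i]), mul_zero]
  set B := ∫ t in Ioi (0 : ℝ), |Real.exp (-((m + 1) * t)) * w t|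
  have hB0 : 0 ≤ B := integral_nonneg fun _ => abs_nonneg _
  -- A nonnegative function, being `e^(-t)` times a square. Approximating its first factor
  -- `φ(e^(-t))` by polynomials shows that its integral vanishes.
  let S : ℝ → ℝ := fun t => Real.exp (-(m * t)) * w t * (Real.exp (-((m + 1) * t)) * w t)
  have hSeq (t : ℝ) : S t = Real.exp (-t) * (Real.exp (-(m * t)) * w t) ^ 2 := by
    simp only [S]
    rw [show -((m + 1) * t) = -t + -(m * t) by ring, Real.exp_add]
    ring
  have hmeas : AEStronglyMeasurable (fun t => Real.exp (-(m * t)) * w t)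
      (volume.restrict (Ioi 0)) := (hint m le_rfl).aestronglyMeasurable
  have hSint : IntegrableOn S (Ioi 0) := by
    refine (hint (m + 1) (by linarith)).bdd_mul (c := A) hmeas ?_
    filter_upwards [ae_restrict_mem measurableSet_Ioi] with t ht
    refine (hbm t (le_of_lt ht)).trans (mul_le_of_le_one_right hA ?_)
    exact Real.exp_le_one_iff.2 (neg_nonpos.2 (le_of_lt ht))
  have hSle (ε : ℝ) (hε : 0 < ε) : ∫ t in Ioi (0 : ℝ), S t ≤ ε * B := by
    obtain ⟨P, hP⟩ := exists_polynomial_near_of_continuousOn 0 1 φ hφc ε hε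
    have hPint : IntegrableOn
        (fun t => P.eval (Real.exp (-t)) * (Real.exp (-((m + 1) * t)) * w t)) (Ioi 0) := by
      obtain ⟨C, hC⟩ := isCompact_Icc.exists_bound_of_continuousOn (s := Icc (0 : ℝ) 1)
        P.continuous.continuousOn
      refine (hint (m + 1) (by linarith)).bdd_mul (c := C)
        (P.continuous.comp (Real.continuous_exp.comp continuous_neg)).aestronglyMeasurable ?_
      filter_upwards [ae_restrict_mem measurableSet_Ioi] with t ht
      exact hC _ ⟨(Real.exp_pos _).le, Real.exp_le_one_iff.2 (neg_nonpos.2 (le_of_lt ht))⟩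
    have := integral_sub hSint hPint
    rw [hpoly P, sub_zero] at this
    rw [← this, ← integral_const_mul]
    refine setIntegral_mono_on (hSint.sub hPint)
      ((hint (m + 1) (by linarith)).abs.const_mul ε) measurableSet_Ioi fun t ht => ?_
    simp only [S]
    rw [← sub_mul, ← hφexp]
    refine (le_abs_self _).trans ?_
    rw [abs_mul]
    gcongr
    rw [abs_sub_comm]
    exact (hP _ ⟨(Real.exp_pos _).le, Real.exp_le_one_iff.2 (neg_nonpos.2 (le_of_lt ht))⟩).le
  have hS0 : ∫ t in Ioi (0 : ℝ), S t = 0 := by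
    refine le_antisymm (le_of_forall_pos_le_add fun ε hε => ?_)
      (integral_nonneg fun t => by rw [hSeq]; positivity)
    calc _ ≤ ε / (B + 1) * B := hSle _ (by positivity)
      _ ≤ 0 + ε := by
        rw [zero_add, div_mul_eq_mul_div, div_le_iff₀ (by positivity)]
        nlinarith
  rw [integral_eq_zero_iff_of_nonneg (fun t => by rw [hSeq, Pi.zero_apply]; positivity) hSint] at hS0
  have hSc : ContinuousOn S (Ioi 0) := by
    have hw' := hw.mono Ioi_subset_Ici_self
    exact ((Continuous.continuousOn (by fun_prop)).mul hw').mul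
      ((Continuous.continuousOn (by fun_prop)).mul hw')
  have := Measure.eqOn_open_of_ae_eq hS0 isOpen_Ioi hSc continuousOn_const (mem_Ioi.2 ht)
  rw [hSeq] at this
  simpa using this

/-- Watson's lemma, to leading order. -/
theorem tendsto_rpow_mul_laplace {q : ℝ → ℝ} {a c C : ℝ} (ha : 0 < a) (hq : Measurable q)
    (hC : ∀ s, 0 < s → |q s| ≤ C) (hc : Tendsto q (𝓝[>] 0) (𝓝 c)) :
    Tendsto (fun t => t ^ a * ∫ s in Ioi (0 : ℝ), Real.exp (-(t * s)) * (s ^ (a - 1) * q s)) atTop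
      (𝓝 (Real.Gamma a * c)) := by
  -- Rescaling `s` to `s/t` freezes the exponential, so only `q(s/t) → c` depends on `t`.
  have hscale : ∀ᶠ t in atTop, ∫ s in Ioi (0 : ℝ), Real.exp (-s) * s ^ (a - 1) * q (t⁻¹ * s) =
      t ^ a * ∫ s in Ioi (0 : ℝ), Real.exp (-(t * s)) * (s ^ (a - 1) * q s) := by
    filter_upwards [eventually_gt_atTop 0] with t ht
    have h := integral_comp_mul_left_Ioi'
      (fun s => Real.exp (-(t * s)) * (s ^ (a - 1) * q s)) 0 (inv_pos.2 ht)
    rw [mul_zero] at h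
    rw [← h, smul_eq_mul, ← mul_assoc, ← integral_const_mul]
    refine setIntegral_congr_fun measurableSet_Ioi fun s hs => ?_
    have hs' : (0 : ℝ) < s := hs
    rw [mul_inv_cancel_left₀ ht.ne', Real.mul_rpow (by positivity) hs'.le,
      Real.inv_rpow ht.le, Real.rpow_sub_one ht.ne']
    have : 0 < t ^ a := by positivity
    field_simp
  refine Tendsto.congr' hscale ?_
  rw [Real.Gamma_eq_integral ha, ← integral_mul_const]
  refine tendsto_integral_filter_of_dominated_convergence
    (fun s => Real.exp (-s) * s ^ (a - 1) * C) ?_ ?_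
    ((Real.GammaIntegral_convergent ha).mul_const C) ?_
  · refine Eventually.of_forall fun t => Measurable.aestronglyMeasurable ?_
    fun_prop
  · filter_upwards [eventually_gt_atTop 0] with t ht
    filter_upwards [ae_restrict_mem measurableSet_Ioi] with s hs
    have hs' : (0 : ℝ) < s := hs
    rw [norm_mul, Real.norm_of_nonneg (by positivity)]
    gcongr
    exact hC _ (by positivity)
  · filter_upwards [ae_restrict_mem measurableSet_Ioi] with s hs
    have hs' : (0 : ℝ) < s := hs
    refine (hc.comp (tendsto_nhdsWithin_iff.2 ⟨?_, ?_⟩)).const_mul _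
    · simpa using tendsto_inv_atTop_zero.mul_const s
    · filter_upwards [eventually_gt_atTop 0] with t ht
      exact mul_pos (inv_pos.2 ht) hs'

/-! ### Laplace transforms of integrable kernels -/

section Laplace

variable {K : ℝ → ℝ}

theorem integrableOn_exp_neg_mul_mul_of_nonneg (hK : IntegrableOn K (Ioi 0)) {t : ℝ} (ht : 0 ≤ t) :
    IntegrableOn (fun s => Real.exp (-(t * s)) * K s) (Ioi 0) := by
  refine hK.bdd_mul (c := 1) (Continuous.aestronglyMeasurable (by fun_prop)) ?_
  filter_upwards [ae_restrict_mem measurableSet_Ioi] with s hs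
  rw [Real.norm_of_nonneg (Real.exp_pos _).le]
  exact Real.exp_le_one_iff.2 (neg_nonpos.2 (mul_nonneg ht (le_of_lt hs)))

theorem abs_laplace_le (hK : IntegrableOn K (Ioi 0)) {t : ℝ} (ht : 0 ≤ t) :
    |∫ s in Ioi (0 : ℝ), Real.exp (-(t * s)) * K s| ≤ ∫ s in Ioi (0 : ℝ), |K s| := by
  rw [← Real.norm_eq_abs]
  refine norm_integral_le_of_norm_le hK.abs ?_
  filter_upwards [ae_restrict_mem measurableSet_Ioi] with s hs
  rw [norm_mul, Real.norm_of_nonneg (Real.exp_pos _).le]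
  refine mul_le_of_le_one_left (abs_nonneg _) ?_
  exact Real.exp_le_one_iff.2 (neg_nonpos.2 (mul_nonneg ht (le_of_lt hs)))

theorem continuousOn_laplace (hK : IntegrableOn K (Ioi 0)) :
    ContinuousOn (fun t => ∫ s in Ioi (0 : ℝ), Real.exp (-(t * s)) * K s) (Ici 0) := by
  refine continuousOn_of_dominated (bound := fun s => |K s|) (fun t ht =>
    (integrableOn_exp_neg_mul_mul_of_nonneg hK ht).aestronglyMeasurable) (fun t ht => ?_) hK.abs ?_
  · filter_upwards [ae_restrict_mem measurableSet_Ioi] with s hs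
    rw [norm_mul, Real.norm_of_nonneg (Real.exp_pos _).le]
    refine mul_le_of_le_one_left (abs_nonneg _) ?_
    exact Real.exp_le_one_iff.2 (neg_nonpos.2 (mul_nonneg ht (le_of_lt hs)))
  · exact Eventually.of_forall fun s => Continuous.continuousOn (by fun_prop)

/-- Integrability of `s * K s` is not required, and it fails for the spectral density. For `x >
t/2`, `e^(xs) ≥ 1 + xs` gives `s e^(-xs) ≤ 2/t`. -/
theorem hasDerivAt_laplace (hK : IntegrableOn K (Ioi 0)) {t : ℝ} (ht : 0 < t) :
    HasDerivAt (fun t => ∫ s in Ioi (0 : ℝ), Real.exp (-(t * s)) * K s)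
      (-∫ s in Ioi (0 : ℝ), Real.exp (-(t * s)) * (s * K s)) t := by
  rw [← integral_neg]
  refine (hasDerivAt_integral_of_dominated_loc_of_deriv_le (bound := fun s => 2 / t * |K s|)
    (μ := volume.restrict (Ioi 0))
    (F := fun t s => Real.exp (-(t * s)) * K s) (F' := fun t s => -(Real.exp (-(t * s)) * (s * K s)))
    (Ioi_mem_nhds (half_lt_self ht)) ?_ (integrableOn_exp_neg_mul_mul_of_nonneg hK ht.le) ?_ ?_
    (hK.abs.const_mul _) ?_).2
  · filter_upwards [Ioi_mem_nhds ht] with x hx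
    exact (integrableOn_exp_neg_mul_mul_of_nonneg hK (le_of_lt hx)).aestronglyMeasurable
  · exact ((Continuous.aestronglyMeasurable (by fun_prop)).mul
      (aestronglyMeasurable_id.mul hK.aestronglyMeasurable)).neg
  · filter_upwards [ae_restrict_mem measurableSet_Ioi] with s hs x hx
    have hs' : (0 : ℝ) < s := hs
    have hx' : t / 2 < x := hx
    rw [norm_neg, ← mul_assoc, norm_mul, Real.norm_of_nonneg (by positivity), Real.norm_eq_abs]
    gcongr
    rw [le_div_iff₀ ht]
    have h1 : x * s + 1 ≤ Real.exp (x * s) := Real.add_one_le_exp _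
    rw [Real.exp_neg, inv_mul_eq_div, div_mul_eq_mul_div, div_le_iff₀ (Real.exp_pos _)]
    nlinarith
  · filter_upwards [ae_restrict_mem measurableSet_Ioi] with s hs x hx
    have h1 : HasDerivAt (fun x => -(x * s)) (-s) x := by
      simpa using ((hasDerivAt_id' x).mul_const s).fun_neg
    refine (h1.exp.mul_const (K s)).congr_deriv ?_
    ring

/-- The iterated Laplace transform is the Stieltjes transform. -/
theorem integral_exp_neg_mul_laplace (hK : IntegrableOn K (Ioi 0)) {p : ℝ} (hp : 0 < p) :
    ∫ t in Ioi (0 : ℝ), Real.exp (-(p * t)) * ∫ s in Ioi (0 : ℝ), Real.exp (-(t * s)) * K s =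
      ∫ s in Ioi (0 : ℝ), K s / (p + s) := by
  let μ : Measure ℝ := volume.restrict (Ioi 0)
  have hint : Integrable (Function.uncurry fun t s : ℝ =>
      Real.exp (-(p * t)) * (Real.exp (-(t * s)) * K s)) (μ.prod μ) := by
    have h0 : Integrable (fun z : ℝ × ℝ => Real.exp (-p * z.1) * K z.2) (μ.prod μ) :=
      (exp_neg_integrableOn_Ioi 0 hp).mul_prod hK
    refine h0.mono ?_ ?_
    · exact (Continuous.aestronglyMeasurable (by fun_prop)).mul
        ((Continuous.aestronglyMeasurable (by fun_prop)).mul hK.aestronglyMeasurable.comp_snd)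
    · rw [show μ.prod μ = (volume.prod volume).restrict (Ioi 0 ×ˢ Ioi 0) from
        Measure.prod_restrict _ _]
      filter_upwards [ae_restrict_mem (measurableSet_Ioi.prod measurableSet_Ioi)] with z hz
      simp only [Function.uncurry, norm_mul, Real.norm_eq_abs, Real.abs_exp]
      rw [neg_mul]
      gcongr
      refine mul_le_of_le_one_left (abs_nonneg _) ?_
      exact Real.exp_le_one_iff.2 (neg_nonpos.2 (mul_nonneg (le_of_lt hz.1) (le_of_lt hz.2)))
  simp_rw [← integral_const_mul]
  rw [integral_integral_swap hint]
  refine setIntegral_congr_fun measurableSet_Ioi fun s hs => ?_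
  have hs' : (0 : ℝ) < s := hs
  have h1 : ∀ t, Real.exp (-(p * t)) * (Real.exp (-(t * s)) * K s) =
      Real.exp (-(p + s) * t) * K s := by
    intro t
    rw [← mul_assoc, ← Real.exp_add]
    ring_nf
  simp_rw [h1]
  rw [integral_mul_const, integral_exp_mul_Ioi (by linarith)]
  rw [mul_zero, Real.exp_zero, neg_div_neg_eq]
  ring

end Laplace

/-! ### The spectral density -/

/-- The squared modulus of `s ^ β + exp (π β i)`. -/
noncomputable def spectralDenom (β s : ℝ) : ℝ :=
  (s ^ β) ^ 2 + 2 * Real.cos (Real.pi * β) * s ^ β + 1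

/-- The density of the measure whose Laplace transform is `t ↦ E_β(-t ^ β)`. -/
noncomputable def spectralDensity (β s : ℝ) : ℝ :=
  s ^ (β - 1) * (Real.sin (Real.pi * β) / Real.pi / spectralDenom β s)

theorem sin_pi_mul_pos (hβ0 : 0 < β) (hβ1 : β < 1) : 0 < Real.sin (Real.pi * β) :=
  Real.sin_pos_of_pos_of_lt_pi (by positivity) (by nlinarith [Real.pi_pos])

/-- The difference is the square of `s^β + cos(πβ)`. -/
theorem sin_sq_le_spectralDenom (β s : ℝ) : Real.sin (Real.pi * β) ^ 2 ≤ spectralDenom β s := by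
  rw [spectralDenom]
  nlinarith [Real.sin_sq_add_cos_sq (Real.pi * β), sq_nonneg (s ^ β + Real.cos (Real.pi * β))]

/-- The difference is the square of `cos(πβ) s^β + 1`. This gives the decay `s^(-β-1)` of the
density at infinity. -/
theorem sin_sq_mul_le_spectralDenom (β s : ℝ) :
    Real.sin (Real.pi * β) ^ 2 * (s ^ β) ^ 2 ≤ spectralDenom β s := by
  rw [spectralDenom]
  have : Real.sin (Real.pi * β) ^ 2 = 1 - Real.cos (Real.pi * β) ^ 2 := by
    linarith [Real.sin_sq_add_cos_sq (Real.pi * β)]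
  rw [this]
  nlinarith [sq_nonneg (Real.cos (Real.pi * β) * s ^ β + 1)]

theorem spectralDenom_pos (hβ0 : 0 < β) (hβ1 : β < 1) (s : ℝ) : 0 < spectralDenom β s :=
  (pow_pos (sin_pi_mul_pos hβ0 hβ1) 2).trans_le (sin_sq_le_spectralDenom β s)

theorem measurable_spectralDenom : Measurable (spectralDenom β) := by
  unfold spectralDenom
  fun_prop

theorem integrableOn_spectralDensity (hβ0 : 0 < β) (hβ1 : β < 1) :
    IntegrableOn (spectralDensity β) (Ioi 0) := by
  have hs := sin_pi_mul_pos hβ0 hβ1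
  set σ := Real.sin (Real.pi * β)
  have hm : Measurable (spectralDensity β) := by
    unfold spectralDensity
    have := measurable_spectralDenom (β := β)
    fun_prop
  have hnn {s : ℝ} (h : 0 < s) : ‖spectralDensity β s‖ = spectralDensity β s := by
    have := spectralDenom_pos hβ0 hβ1 s
    rw [Real.norm_of_nonneg]
    unfold spectralDensity
    positivity
  rw [← Ioc_union_Ioi_eq_Ioi zero_le_one]
  refine IntegrableOn.union ?_ ?_
  · have h0 : IntegrableOn (fun s : ℝ => s ^ (β - 1)) (Ioc 0 1) :=
      (intervalIntegrable_iff_integrableOn_Ioc_of_le zero_le_one).1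
        (intervalIntegral.intervalIntegrable_rpow' (by linarith))
    refine (h0.mul_const (σ / Real.pi / σ ^ 2)).mono' hm.aestronglyMeasurable ?_
    filter_upwards [ae_restrict_mem measurableSet_Ioc] with s h
    have h' := h.1
    rw [hnn h', spectralDensity]
    gcongr
    exact sin_sq_le_spectralDenom β s
  · have h0 : IntegrableOn (fun s : ℝ => s ^ (-β - 1)) (Ioi 1) :=
      integrableOn_Ioi_rpow_of_lt (by linarith) one_pos
    refine (h0.mul_const (σ / Real.pi / σ ^ 2)).mono' hm.aestronglyMeasurable ?_
    filter_upwards [ae_restrict_mem measurableSet_Ioi] with s h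
    have h' : (0 : ℝ) < s := one_pos.trans h
    rw [hnn h', spectralDensity]
    calc _ ≤ s ^ (β - 1) * (σ / Real.pi / (σ ^ 2 * (s ^ β) ^ 2)) := by
          gcongr
          exact sin_sq_mul_le_spectralDenom β s
      _ = s ^ (-β - 1) * (σ / Real.pi / σ ^ 2) := by
          rw [show -β - 1 = (β - 1) - β * (2 : ℕ) by push_cast; ring, Real.rpow_sub h' (β - 1),
            Real.rpow_mul_natCast h'.le]
          field_simp

/-! ### Cauchy's theorem on the strip `|Im w| ≤ π` -/

section Contour

open Complex

theorem exp_add_one_ne_zero {z : ℂ} (h1 : -Real.pi < z.im) (h2 : z.im < Real.pi) :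
    exp z + 1 ≠ 0 := by
  intro h
  have hlog := log_exp h1 h2.le
  rw [eq_neg_of_add_eq_zero_left h, log_neg_one] at hlog
  rw [← hlog] at h2
  simp at h2

/-- A limit along `comap re l` is uniform in the imaginary part, so `F` is eventually bounded on
whole vertical lines and dominated convergence applies. -/
theorem tendsto_integral_vertical {F : ℂ → ℂ} {L : ℂ} {l : Filter ℝ} [l.IsCountablyGenerated]
    (hF : Measurable F) (h : Tendsto F (comap re l) (𝓝 L)) (a b : ℝ) :
    Tendsto (fun R : ℝ => ∫ y in a..b, F (R + y * I)) l (𝓝 ((b - a) * L)) := by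
  have hev := h.norm.eventually (gt_mem_nhds (lt_add_one ‖L‖))
  rw [eventually_comap] at hev
  have hL : ((b - a) * L : ℂ) = ∫ y in a..b, L := by
    rw [intervalIntegral.integral_const, real_smul]
    push_cast
    rfl
  rw [hL]
  refine intervalIntegral.tendsto_integral_filter_of_dominated_convergence (fun _ => ‖L‖ + 1)
    ?_ ?_ intervalIntegrable_const ?_
  · refine Eventually.of_forall fun R => Measurable.aestronglyMeasurable ?_
    exact hF.comp (by fun_prop)
  · filter_upwards [hev] with R hR
    exact Eventually.of_forall fun y _ => (hR _ (by simp)).le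
  · refine Eventually.of_forall fun y _ => h.comp ?_
    rw [tendsto_comap_iff]
    refine tendsto_id.congr fun R => ?_
    simp

theorem tendsto_exp_mul_comap_re_atBot {c : ℝ} (hc : 0 < c) :
    Tendsto (fun w : ℂ => exp (c * w)) (comap re atBot) (𝓝 0) := by
  rw [tendsto_exp_nhds_zero_iff]
  simp only [re_ofReal_mul]
  exact tendsto_comap.const_mul_atBot hc

theorem tendsto_exp_neg_mul_comap_re_atTop {c : ℝ} (hc : 0 < c) :
    Tendsto (fun w : ℂ => exp (-(c * w))) (comap re atTop) (𝓝 0) := by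
  rw [tendsto_exp_nhds_zero_iff]
  simp only [neg_re, re_ofReal_mul]
  exact tendsto_neg_atTop_atBot.comp (tendsto_comap.const_mul_atTop hc)

/-- The difference of the values on the two sides of the cut. -/
theorem exp_div_exp_add_one_sub (hβ0 : 0 < β) (hβ1 : β < 1) (x : ℝ) :
    exp (β * (x + (-Real.pi : ℝ) * I)) / (exp (β * (x + (-Real.pi : ℝ) * I)) + 1) -
      exp (β * (x + Real.pi * I)) / (exp (β * (x + Real.pi * I)) + 1) =
      ((-2 * Real.sin (Real.pi * β) * Real.exp x ^ β / spectralDenom β (Real.exp x) : ℝ) : ℂ) *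
        I := by
  have hθ : Real.pi * β < Real.pi := by nlinarith [Real.pi_pos]
  have hθ0 : 0 < Real.pi * β := by positivity
  have hD := spectralDenom_pos hβ0 hβ1 (Real.exp x)
  have hy : spectralDenom β (Real.exp x) = (Real.exp x ^ β) ^ 2 +
    2 * Real.cos (Real.pi * β) * Real.exp x ^ β + 1 := rfl
  have hyx : Real.exp x ^ β = Real.exp (β * x) := by rw [← Real.exp_mul, mul_comm]
  set y : ℝ := Real.exp x ^ β
  set E := exp ((Real.pi * β : ℝ) * I) with hE
  set E' := exp (-((Real.pi * β : ℝ) * I)) with hE'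
  have h1 : exp (β * (x + Real.pi * I)) = y * E := by
    rw [hyx, ofReal_exp, hE, ← exp_add]
    push_cast
    ring_nf
  have h2 : exp (β * (x + (-Real.pi : ℝ) * I)) = y * E' := by
    rw [hyx, ofReal_exp, hE', ← exp_add]
    push_cast
    ring_nf
  have hn1 : exp (β * (x + Real.pi * I)) + 1 ≠ 0 := by
    refine exp_add_one_ne_zero ?_ ?_ <;> simp <;> nlinarith
  have hn2 : exp (β * (x + (-Real.pi : ℝ) * I)) + 1 ≠ 0 := by
    refine exp_add_one_ne_zero ?_ ?_ <;> simp <;> nlinarith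
  have hcos : E + E' = 2 * (Real.cos (Real.pi * β) : ℂ) := by
    rw [ofReal_cos, two_cos, neg_mul]
  have hsin : E' - E = -2 * (Real.sin (Real.pi * β) : ℂ) * I := by
    have := two_sin ((Real.pi * β : ℝ) : ℂ)
    rw [neg_mul] at this
    rw [ofReal_sin, neg_mul, this, neg_mul, mul_assoc, I_mul_I]
    ring
  have hprod : E * E' = 1 := by
    rw [hE, hE', ← exp_add, add_neg_cancel, exp_zero]
  rw [h1] at hn1 ⊢
  rw [h2] at hn2 ⊢
  -- Expand the product using `E * E' = 1` and `E + E' = 2 cos(πβ)`.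
  have hDeq : (spectralDenom β (Real.exp x) : ℂ) = (y * E' + 1) * (y * E + 1) := by
    rw [hy]
    simp only [ofReal_add, ofReal_mul, ofReal_pow, ofReal_one, ofReal_ofNat]
    linear_combination -(y : ℂ) ^ 2 * hprod - y * hcos
  rw [div_sub_div _ _ hn2 hn1, ofReal_div, hDeq]
  simp only [ofReal_mul, ofReal_neg, ofReal_ofNat]
  rw [div_mul_eq_mul_div]
  congr 1
  linear_combination (y : ℂ) * hsin

theorem integral_comp_exp (g : ℝ → ℝ) :
    ∫ s in Ioi (0 : ℝ), g s = ∫ x : ℝ, Real.exp x * g (Real.exp x) := by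
  have h := integral_image_eq_integral_abs_deriv_smul MeasurableSet.univ
    (fun x _ => (Real.hasDerivAt_exp x).hasDerivWithinAt) Real.exp_injective.injOn g
  rw [image_univ, Real.range_exp] at h
  simpa [Real.abs_exp] using h

theorem integrable_comp_exp {g : ℝ → ℝ} (hg : IntegrableOn g (Ioi 0)) :
    Integrable fun x : ℝ => Real.exp x * g (Real.exp x) := by
  have h := integrableOn_image_iff_integrableOn_abs_deriv_smul MeasurableSet.univ
    (fun x _ => (Real.hasDerivAt_exp x).hasDerivWithinAt) Real.exp_injective.injOn g
  rw [image_univ, Real.range_exp] at h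
  simpa [Real.abs_exp] using h.1 hg

/-- The quotient of the two slopes removes the singularity at `x₀`. In the closed strip `exp w = exp
x₀` only at `w = x₀`, because the period is `2πi`, and `exp (β w) ≠ -1` because `β < 1`. -/
theorem differentiableOn_dslope_div_dslope_exp (hβ0 : 0 < β) (hβ1 : β < 1) (x₀ : ℝ) :
    DifferentiableOn ℂ (fun w => dslope (fun w => exp (β * w) / (exp (β * w) + 1)) x₀ w /
      dslope exp x₀ w) {w | w.im ∈ Icc (-Real.pi) Real.pi} := by
  have hS : {w : ℂ | w.im ∈ Icc (-Real.pi) Real.pi} ∈ 𝓝 (x₀ : ℂ) := by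
    refine continuous_im.continuousAt.preimage_mem_nhds (Icc_mem_nhds ?_ ?_) <;>
      simp [Real.pi_pos]
  refine DifferentiableOn.div ((differentiableOn_dslope hS).2 ?_)
    ((differentiableOn_dslope hS).2 differentiable_exp.differentiableOn) fun w hw => ?_
  · refine DifferentiableOn.div (Differentiable.differentiableOn (by fun_prop))
      (Differentiable.differentiableOn (by fun_prop)) fun w hw => ?_
    have h1 : -Real.pi ≤ w.im := hw.1
    have h2 : w.im ≤ Real.pi := hw.2
    have := Real.pi_pos
    refine exp_add_one_ne_zero ?_ ?_ <;> rw [im_ofReal_mul] <;> nlinarith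
  · rcases eq_or_ne w x₀ with rfl | hne
    · simp [exp_ne_zero]
    · rw [dslope_of_ne _ hne, slope_def_field]
      refine div_ne_zero (sub_ne_zero.2 fun h => hne ?_) (sub_ne_zero.2 hne)
      obtain ⟨n, hn⟩ := exp_eq_exp_iff_exists_int.1 h
      have him := congrArg im hn
      simp only [add_im, ofReal_im, mul_im, intCast_re, intCast_im, mul_re, re_ofNat, im_ofNat,
        ofReal_re, I_re, I_im] at him
      have hn0 : n = 0 := by
        have h1 : -Real.pi ≤ w.im := hw.1
        have h2 : w.im ≤ Real.pi := hw.2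
        have hpi := Real.pi_pos
        have h3 : (n : ℝ) < 1 := by nlinarith
        have h4 : (-1 : ℝ) < n := by nlinarith
        have h3' : n < 1 := by exact_mod_cast h3
        have h4' : -1 < n := by exact_mod_cast h4
        omega
      simpa [hn0] using hn

/-- The Stieltjes transform of the spectral density, by Cauchy's theorem on the slit plane in
logarithmic coordinates. -/
theorem integral_spectralDensity_div (hβ0 : 0 < β) (hβ1 : β < 1) {p : ℝ} (hp : 0 < p) :
    ∫ s in Ioi (0 : ℝ), spectralDensity β s / (p + s) = p ^ (β - 1) / (p ^ β + 1) := by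
  have hpi := Real.pi_pos
  -- In the coordinate `z = e^w`, this is `z^β / (z^β + 1)`, and the slit plane becomes the strip.
  let G : ℂ → ℂ := fun w => exp (β * w) / (exp (β * w) + 1)
  have hexp0 : exp (Real.log p : ℂ) = p := by rw [← ofReal_exp, Real.exp_log hp]
  have hG0 : G (Real.log p) = ((p ^ β / (p ^ β + 1) : ℝ) : ℂ) := by
    simp only [G]
    rw [Real.rpow_def_of_pos hp]
    push_cast
    ring_nf
  set G₀ : ℂ := G (Real.log p)
  -- Subtracting `G₀` cancels the pole at `log p`. `F` is the explicit form used for limits, `f`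
  -- below its holomorphic extension used for Cauchy's theorem.
  let F : ℂ → ℂ := fun w => (G w - G₀) / (exp w - p)
  let f : ℂ → ℂ := fun w => dslope G (Real.log p) w / dslope exp (Real.log p) w
  have hfF {w : ℂ} (hw : w ≠ Real.log p) : f w = F w := by
    have := sub_ne_zero.2 hw
    simp only [f, F]
    rw [dslope_of_ne _ hw, dslope_of_ne _ hw, slope_def_field, slope_def_field, hexp0,
      div_div_div_cancel_right₀ this]
  have hFm : Measurable F := by
    simp only [F, G]
    fun_prop
  -- This nonzero limit at `z = 0` supplies the value of the integral; the right side contributes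
  -- nothing.
  have hleft : Tendsto F (comap re atBot) (𝓝 (G₀ / p)) := by
    have h1 : Tendsto (fun w => exp (β * w)) (comap re atBot) (𝓝 0) :=
      tendsto_exp_mul_comap_re_atBot hβ0
    have h2 : Tendsto exp (comap re atBot) (𝓝 0) := tendsto_exp_comap_re_atBot
    have := ((h1.div (h1.add_const 1) (by simp)).sub_const G₀).div (h2.sub_const (p : ℂ))
      (by simpa using hp.ne')
    rw [zero_div, zero_sub, zero_sub, neg_div_neg_eq] at this
    exact this
  have hright : Tendsto F (comap re atTop) (𝓝 0) := by
    have h1 : Tendsto (fun w => exp (-(β * w))) (comap re atTop) (𝓝 0) :=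
      tendsto_exp_neg_mul_comap_re_atTop hβ0
    have h2 : Tendsto (fun w : ℂ => exp (-w)) (comap re atTop) (𝓝 0) := by
      simpa using tendsto_exp_neg_mul_comap_re_atTop one_pos
    have := ((((h1.const_add 1).inv₀ (by simp)).sub_const G₀).mul h2).div
      ((h2.const_mul (p : ℂ)).const_sub 1) (by simp)
    simp only [mul_zero, zero_div] at this
    refine this.congr fun w => ?_
    simp only [F, G, Pi.div_apply]
    rw [exp_neg, exp_neg]
    have e1 := exp_ne_zero w
    have e2 := exp_ne_zero (β * w)
    have e3 : exp (β * w) / (exp (β * w) + 1) = (1 + (exp (β * w))⁻¹)⁻¹ := by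
      rw [← inv_div, add_div, div_self e2, one_div]
    rw [e3, ← div_eq_mul_inv, div_div, mul_sub, mul_one, mul_left_comm, mul_inv_cancel₀ e1, mul_one]
  have hright' := tendsto_integral_vertical hFm hright (-Real.pi) Real.pi
  have hleft' := (tendsto_integral_vertical hFm hleft (-Real.pi) Real.pi).comp
    tendsto_neg_atTop_atBot
  let H : ℝ → ℝ := fun x => Real.exp x * (spectralDensity β (Real.exp x) / (p + Real.exp x))
  have hHint : Integrable H := by
    refine integrable_comp_exp (g := fun s => spectralDensity β s / (p + s)) ?_
    simp_rw [div_eq_mul_inv]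
    refine (integrableOn_spectralDensity hβ0 hβ1).mul_bdd (c := p⁻¹)
      (Measurable.aestronglyMeasurable (by fun_prop)) ?_
    filter_upwards [ae_restrict_mem measurableSet_Ioi] with s hs
    have hs' : (0 : ℝ) < s := hs
    rw [Real.norm_of_nonneg (by positivity)]
    gcongr
    linarith
  -- On both horizontal sides `e^w = -e^x`, so the denominators agree, `G₀` cancels, and only the
  -- jump of `G` remains.
  have hhor (x : ℝ) : f (x + (-Real.pi : ℝ) * I) - f (x + Real.pi * I) =
      ((2 * Real.pi * H x : ℝ) : ℂ) * I := by
    have hne (y : ℝ) (hy : y ≠ 0) : (x + y * I : ℂ) ≠ Real.log p := fun h => hy (by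
      simpa using congrArg im h)
    have he1 : exp (x + (-Real.pi : ℝ) * I) = -(Real.exp x : ℂ) := by
      rw [exp_add, ofReal_neg, neg_mul, exp_neg, exp_pi_mul_I, ofReal_exp]
      simp
    have he2 : exp (x + Real.pi * I) = -(Real.exp x : ℂ) := by
      rw [exp_add, exp_pi_mul_I, ofReal_exp]
      simp
    rw [hfF (hne _ (neg_ne_zero.2 hpi.ne')), hfF (hne _ hpi.ne')]
    simp only [F]
    rw [he1, he2, ← sub_div, sub_sub_sub_cancel_right]
    simp only [G]
    rw [exp_div_exp_add_one_sub hβ0 hβ1, show (-(Real.exp x : ℂ) - p) = ((-(p + Real.exp x) : ℝ) : ℂ)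
      by push_cast; ring, mul_div_right_comm, ← ofReal_div]
    congr 2
    simp only [H, spectralDensity]
    rw [Real.rpow_sub_one (Real.exp_pos x).ne']
    have := Real.exp_pos x
    have := spectralDenom_pos hβ0 hβ1 (Real.exp x)
    field_simp
  have hdiff := differentiableOn_dslope_div_dslope_exp hβ0 hβ1 (Real.log p)
  -- The condition on `R` keeps `log p` off the vertical sides, where `f` is replaced by `F`.
  have hrect (R : ℝ) (hR : |Real.log p| < R) :
      ((2 * Real.pi * ∫ x in -R..R, H x : ℝ) : ℂ) +
        (∫ y in -Real.pi..Real.pi, F (R + y * I)) -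
        (∫ y in -Real.pi..Real.pi, F ((-R : ℝ) + y * I)) = 0 := by
    have hcauchy := integral_boundary_rect_eq_zero_of_differentiableOn f
      ⟨-R, -Real.pi⟩ ⟨R, Real.pi⟩ (hdiff.mono fun w hw => by
        have := hw.2
        rwa [uIcc_of_le (by linarith : (-Real.pi) ≤ Real.pi)] at this)
    simp only at hcauchy
    have hcont {y : ℝ} (hy : y ∈ Icc (-Real.pi) Real.pi) :
        IntervalIntegrable (fun x : ℝ => f (x + y * I)) volume (-R) R :=
      (ContinuousOn.comp_continuous hdiff.continuousOn (by fun_prop)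
        fun x => by simpa using hy).intervalIntegrable _ _
    rw [← intervalIntegral.integral_sub (hcont (by constructor <;> linarith))
      (hcont (by constructor <;> linarith))] at hcauchy
    simp_rw [hhor] at hcauchy
    rw [intervalIntegral.integral_mul_const, intervalIntegral.integral_ofReal,
      intervalIntegral.integral_const_mul] at hcauchy
    have hv (x : ℝ) (hx : x ≠ Real.log p) :
        ∫ y in -Real.pi..Real.pi, f (x + y * I) = ∫ y in -Real.pi..Real.pi, F (x + y * I) :=
      intervalIntegral.integral_congr fun y _ => hfF fun h => hx (by simpa using congrArg re h)
    rw [hv R (by rintro rfl; exact (le_abs_self _).not_gt hR),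
      hv (-R) (fun h => by rw [← h, abs_neg] at hR; exact (le_abs_self _).not_gt hR),
      smul_eq_mul, smul_eq_mul] at hcauchy
    apply mul_left_cancel₀ I_ne_zero
    rw [mul_zero]
    linear_combination hcauchy
  have hlim : Tendsto (fun R : ℝ => ((2 * Real.pi * ∫ x in -R..R, H x : ℝ) : ℂ) +
        (∫ y in -Real.pi..Real.pi, F (R + y * I)) -
        (∫ y in -Real.pi..Real.pi, F ((-R : ℝ) + y * I))) atTop
      (𝓝 (((2 * Real.pi * ∫ x, H x : ℝ) : ℂ) + ((Real.pi : ℝ) - (-Real.pi : ℝ)) * 0 -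
        ((Real.pi : ℝ) - (-Real.pi : ℝ)) * (G₀ / p))) := by
    refine (Tendsto.add ?_ hright').sub hleft'
    exact (continuous_ofReal.tendsto _).comp
      ((intervalIntegral_tendsto_integral hHint tendsto_neg_atTop_atBot tendsto_id).const_mul _)
  have hzero : ((2 * Real.pi * ∫ x, H x : ℝ) : ℂ) + ((Real.pi : ℝ) - (-Real.pi : ℝ)) * 0 -
        ((Real.pi : ℝ) - (-Real.pi : ℝ)) * (G₀ / p) = 0 := by
    refine tendsto_nhds_unique hlim (tendsto_const_nhds.congr' ?_)
    filter_upwards [eventually_gt_atTop |Real.log p|] with R hR using (hrect R hR).symm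
  rw [hG0, ← ofReal_sub, ← ofReal_div, ← ofReal_mul, mul_zero, add_zero, ← ofReal_sub,
    ofReal_eq_zero] at hzero
  have hH : ∫ s in Ioi (0 : ℝ), spectralDensity β s / (p + s) = ∫ x, H x := integral_comp_exp _
  rw [hH, Real.rpow_sub_one hp.ne']
  have h2 : 2 * Real.pi * ∫ x, H x = 2 * Real.pi * (p ^ β / (p ^ β + 1) / p) := by linarith
  rw [mul_left_cancel₀ (by positivity) h2, div_right_comm]

end Contour

/-! ### Spectral representation of `E_β(-t^β)` -/

/-- The Laplace transform of the spectral density. -/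
noncomputable def spectralLaplace (β t : ℝ) : ℝ :=
  ∫ s in Ioi (0 : ℝ), Real.exp (-(t * s)) * spectralDensity β s

/-- Gamma integrals cancel the coefficients and leave a geometric series of ratio `-p^(-β)`; `p > 1`
makes it converge absolutely and justifies the exchange. -/
theorem integral_exp_neg_mul_mittagLeffler (hβ : 0 < β) {p : ℝ} (hp : 1 < p) :
    ∫ t in Ioi (0 : ℝ), Real.exp (-(p * t)) * mittagLeffler β (-t ^ β) =
      p ^ (β - 1) / (p ^ β + 1) := by
  have hp0 : 0 < p := one_pos.trans hp
  have hpβ : 1 < p ^ β := Real.one_lt_rpow hp hβ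
  let f : ℕ → ℝ → ℝ := fun k t =>
    (-1) ^ k / Real.Gamma (k * β + 1) * (t ^ (k * β + 1 - 1) * Real.exp (-(p * t)))
  have hG (k : ℕ) : 0 < Real.Gamma (k * β + 1) := Real.Gamma_pos_of_pos (by positivity)
  have hI (k : ℕ) : ∫ t in Ioi (0 : ℝ), t ^ (k * β + 1 - 1) * Real.exp (-(p * t)) =
      p⁻¹ * ((p ^ β)⁻¹) ^ k * Real.Gamma (k * β + 1) := by
    rw [Real.integral_rpow_mul_exp_neg_mul_Ioi (by positivity) hp0, one_div, Real.inv_rpow hp0.le,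
      Real.rpow_add_one hp0.ne', mul_comm (k : ℝ), Real.rpow_mul_natCast hp0.le, mul_inv, inv_pow,
      mul_comm p⁻¹]
  have hint (k : ℕ) : IntegrableOn (f k) (Ioi 0) := by
    refine Integrable.const_mul ?_ _
    by_contra hn
    have := hI k
    rw [integral_undef hn] at this
    have : 0 < p⁻¹ * ((p ^ β)⁻¹) ^ k * Real.Gamma (k * β + 1) :=
      mul_pos (by positivity) (hG k)
    linarith
  have hnorm (k : ℕ) : ∫ t in Ioi (0 : ℝ), ‖f k t‖ = p⁻¹ * ((p ^ β)⁻¹) ^ k := by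
    rw [show ∫ t in Ioi (0 : ℝ), ‖f k t‖ = ∫ t in Ioi (0 : ℝ), 1 / Real.Gamma (k * β + 1) *
      (t ^ (k * β + 1 - 1) * Real.exp (-(p * t))) from
        setIntegral_congr_fun measurableSet_Ioi fun t ht => ?_, integral_const_mul, hI]
    · have := hG k
      field_simp
    · have ht' : (0 : ℝ) < t := ht
      simp only [f]
      rw [norm_mul, norm_div, norm_pow, norm_neg, norm_one, one_pow, Real.norm_of_nonneg (hG k).le,
        Real.norm_of_nonneg (by positivity)]
  have hgeom : ‖-(p ^ β)⁻¹‖ < 1 := by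
    rw [norm_neg, Real.norm_of_nonneg (by positivity)]
    exact inv_lt_one_of_one_lt₀ hpβ
  have hsum := hasSum_integral_of_summable_integral_norm hint (by
    simp_rw [hnorm]
    exact (summable_geometric_of_lt_one (by positivity) (inv_lt_one_of_one_lt₀ hpβ)).mul_left _)
  have hval (k : ℕ) : ∫ t in Ioi (0 : ℝ), f k t = p⁻¹ * (-(p ^ β)⁻¹) ^ k := by
    have := hG k
    simp only [f]
    rw [integral_const_mul, hI, neg_pow (p ^ β)⁻¹]
    field_simp
  simp_rw [hval] at hsum
  have h := hsum.unique ((hasSum_geometric_of_norm_lt_one hgeom).mul_left p⁻¹)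
  rw [show p ^ (β - 1) / (p ^ β + 1) = p⁻¹ * (1 - -(p ^ β)⁻¹)⁻¹ by
    rw [Real.rpow_sub_one hp0.ne', sub_neg_eq_add]
    field_simp, ← h]
  refine setIntegral_congr_fun measurableSet_Ioi fun t ht => ?_
  have ht' : (0 : ℝ) < t := ht
  simp only [f]
  rw [mittagLeffler, ← tsum_mul_left]
  refine tsum_congr fun k => ?_
  rw [neg_pow, ← Real.rpow_mul_natCast ht'.le, add_sub_cancel_right, mul_comm β]
  ring

/-- The spectral representation of the Mittag-Leffler function on the negative half-line. -/
theorem mittagLeffler_neg_rpow (hβ0 : 0 < β) (hβ1 : β < 1) {t : ℝ} (ht : 0 < t) :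
    mittagLeffler β (-t ^ β) = spectralLaplace β t := by
  have hK := integrableOn_spectralDensity hβ0 hβ1
  set B := ∫ s in Ioi (0 : ℝ), |spectralDensity β s|
  have hB : 0 ≤ B := integral_nonneg fun _ => abs_nonneg _
  have hc1 : ContinuousOn (fun t : ℝ => mittagLeffler β (-t ^ β)) (Ici 0) :=
    ((contDiff_mittagLeffler hβ0).continuous.comp
      (Real.continuous_rpow_const hβ0.le).neg).continuousOn
  have hc2 : ContinuousOn (spectralLaplace β) (Ici 0) := continuousOn_laplace hK
  -- The exponential type: `(2 t^β)^(1/β) = a t`.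
  set a : ℝ := 2 ^ β⁻¹
  have ha : 0 < a := by positivity
  have hb1 (t : ℝ) (ht : 0 ≤ t) : |mittagLeffler β (-t ^ β)| ≤ 2 * Real.exp (a * t) := by
    have := abs_mittagLeffler_le hβ0 (-t ^ β)
    rwa [abs_neg (t ^ β), abs_of_nonneg (Real.rpow_nonneg ht β), Real.mul_rpow zero_le_two (by positivity),
      Real.rpow_rpow_inv ht hβ0.ne'] at this
  have hb2 (t : ℝ) (ht : 0 ≤ t) : |spectralLaplace β t| ≤ B * Real.exp (a * t) :=
    (abs_laplace_le hK ht).trans (le_mul_of_one_le_right hB (Real.one_le_exp (by positivity)))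
  rw [← sub_eq_zero]
  refine eq_zero_of_laplace_eq_zero (w := fun t => mittagLeffler β (-t ^ β) - spectralLaplace β t)
    (A := 2 + B) (a := a) (p₀ := max a 1) (hc1.sub hc2) (fun t ht => ?_) (fun p hp => ?_) ht
  · calc _ ≤ _ := abs_sub _ _
      _ ≤ 2 * Real.exp (a * t) + B * Real.exp (a * t) := add_le_add (hb1 t ht) (hb2 t ht)
      _ = _ := by ring
  · have hpa := (le_max_left _ _).trans_lt hp
    have hp1 := (le_max_right _ _).trans_lt hp
    have hp0 : 0 < p := one_pos.trans hp1
    simp only [mul_sub]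
    rw [integral_sub (integrableOn_exp_neg_mul_mul hc1 hb1 hpa)
      (integrableOn_exp_neg_mul_mul hc2 hb2 hpa), integral_exp_neg_mul_mittagLeffler hβ0 hp1]
    simp only [spectralLaplace]
    rw [integral_exp_neg_mul_laplace hK hp0, integral_spectralDensity_div hβ0 hβ1 hp0, sub_self]

/-! ### Asymptotics at infinity -/

theorem abs_sin_div_spectralDenom_le (hβ0 : 0 < β) (hβ1 : β < 1) (s : ℝ) :
    |Real.sin (Real.pi * β) / Real.pi / spectralDenom β s| ≤
      Real.sin (Real.pi * β) / Real.pi / Real.sin (Real.pi * β) ^ 2 := by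
  have := sin_pi_mul_pos hβ0 hβ1
  have := spectralDenom_pos hβ0 hβ1 s
  rw [abs_of_nonneg (by positivity)]
  gcongr
  exact sin_sq_le_spectralDenom β s

theorem tendsto_sin_div_spectralDenom (hβ0 : 0 < β) :
    Tendsto (fun s => Real.sin (Real.pi * β) / Real.pi / spectralDenom β s) (𝓝[>] 0)
      (𝓝 (Real.sin (Real.pi * β) / Real.pi)) := by
  have h1 : Continuous (spectralDenom β) := by
    have := Real.continuous_rpow_const hβ0.le
    unfold spectralDenom
    fun_prop
  have h2 : spectralDenom β 0 = 1 := by simp [spectralDenom, Real.zero_rpow hβ0.ne']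
  have h3 := (tendsto_const_nhds (x := Real.sin (Real.pi * β) / Real.pi)).div (h1.tendsto 0)
    (by simp [h2])
  rw [h2, div_one] at h3
  exact h3.mono_left nhdsWithin_le_nhds

theorem tendsto_rpow_mul_spectralLaplace (hβ0 : 0 < β) (hβ1 : β < 1) :
    Tendsto (fun t => t ^ β * spectralLaplace β t) atTop
      (𝓝 (Real.Gamma β * (Real.sin (Real.pi * β) / Real.pi))) :=
  tendsto_rpow_mul_laplace hβ0 (measurable_const.div measurable_spectralDenom)
    (fun s _ => abs_sin_div_spectralDenom_le hβ0 hβ1 s) (tendsto_sin_div_spectralDenom hβ0)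

/-- Differentiation inserts a factor `-s`, so Watson's lemma applies with the same bounded factor
and exponent `β + 1`. -/
theorem tendsto_rpow_mul_deriv_spectralLaplace (hβ0 : 0 < β) (hβ1 : β < 1) :
    Tendsto (fun t => t ^ (β + 1) * deriv (spectralLaplace β) t) atTop
      (𝓝 (-(Real.Gamma (β + 1) * (Real.sin (Real.pi * β) / Real.pi)))) := by
  have h := (tendsto_rpow_mul_laplace (a := β + 1) (by linarith)
    (measurable_const.div measurable_spectralDenom)
    (fun s _ => abs_sin_div_spectralDenom_le hβ0 hβ1 s) (tendsto_sin_div_spectralDenom hβ0)).neg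
  refine h.congr' ?_
  filter_upwards [eventually_gt_atTop 0] with t ht
  have hd : HasDerivAt (spectralLaplace β) _ t :=
    hasDerivAt_laplace (integrableOn_spectralDensity hβ0 hβ1) ht
  rw [hd.deriv, mul_neg]
  congr 2
  refine setIntegral_congr_fun measurableSet_Ioi fun s hs => ?_
  have hs' : (0 : ℝ) < s := hs
  simp only [spectralDensity, add_sub_cancel_right]
  rw [Real.rpow_sub_one hs'.ne', ← mul_assoc s, mul_div_cancel₀ _ hs'.ne']
  rfl

theorem tendsto_mul_deriv_div_spectralLaplace (hβ0 : 0 < β) (hβ1 : β < 1) :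
    Tendsto (fun t => t * deriv (spectralLaplace β) t / spectralLaplace β t) atTop (𝓝 (-β)) := by
  have hσ := sin_pi_mul_pos hβ0 hβ1
  have hG := Real.Gamma_pos_of_pos hβ0
  have hpi := Real.pi_pos
  have h := (tendsto_rpow_mul_deriv_spectralLaplace hβ0 hβ1).div
    (tendsto_rpow_mul_spectralLaplace hβ0 hβ1) (by positivity)
  rw [Real.Gamma_add_one hβ0.ne', show -(β * Real.Gamma β * (Real.sin (Real.pi * β) / Real.pi)) /
    (Real.Gamma β * (Real.sin (Real.pi * β) / Real.pi)) = -β by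
      rw [mul_assoc, neg_div, mul_div_cancel_right₀ _ (by positivity)]] at h
  refine h.congr' ?_
  filter_upwards [eventually_gt_atTop 0] with t ht
  have : 0 < t ^ β := by positivity
  simp only [Pi.div_apply]
  rw [Real.rpow_add_one ht.ne', mul_assoc, mul_div_mul_left _ _ this.ne']

theorem mittagLeffler_neg_isEquivalent (hβ0 : 0 < β) (hβ1 : β < 1) :
    (fun x : ℝ => mittagLeffler β (-x)) ~[atTop] (fun x : ℝ => x⁻¹ / Real.Gamma (1 - β)) := by
  have hG := Real.Gamma_pos_of_pos (sub_pos.2 hβ1)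
  have hσ := sin_pi_mul_pos hβ0 hβ1
  rw [Asymptotics.isEquivalent_iff_tendsto_one (by
    filter_upwards [eventually_gt_atTop 0] with x hx
    positivity)]
  have h := ((tendsto_rpow_mul_spectralLaplace hβ0 hβ1).mul_const (Real.Gamma (1 - β))).comp
    (tendsto_rpow_atTop (inv_pos.2 hβ0))
  -- Euler's reflection formula.
  have hone : Real.Gamma β * (Real.sin (Real.pi * β) / Real.pi) * Real.Gamma (1 - β) = 1 := by
    rw [mul_right_comm, Real.Gamma_mul_Gamma_one_sub]
    have := Real.pi_pos
    field_simp
  rw [hone] at h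
  refine h.congr' ?_
  filter_upwards [eventually_gt_atTop 0] with x hx
  simp only [Function.comp, Pi.div_apply]
  rw [← mittagLeffler_neg_rpow hβ0 hβ1 (by positivity), Real.rpow_inv_rpow hx.le hβ0.ne']
  field_simp

theorem IsCaputoSolution.tendsto_mul_deriv_div (hβ0 : 0 < β) (hβ1 : β < 1) {r : ℝ} (hr : r < 0)
    {u : ℝ → ℝ} (hu : IsCaputoSolution β r u) :
    Tendsto (fun t => t * deriv u t / u t) atTop (𝓝 (-β)) := by
  have hr' : 0 < -r := neg_pos.2 hr
  -- Chosen so that `(c t)^β = -r t^β`; the quantity `t u'/u` is invariant under this rescaling of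
  -- `t`.
  set c : ℝ := (-r) ^ β⁻¹
  have hc : 0 < c := by positivity
  have hu' {t : ℝ} (ht : 0 < t) : u t = spectralLaplace β (c * t) := by
    rw [hu.unique hβ0 hβ1 (isCaputoSolution_mittagLeffler hβ0 hβ1 r) ht.le,
      ← mittagLeffler_neg_rpow hβ0 hβ1 (by positivity), Real.mul_rpow hc.le ht.le,
      Real.rpow_inv_rpow hr'.le hβ0.ne', neg_mul, neg_neg]
  have h := (tendsto_mul_deriv_div_spectralLaplace hβ0 hβ1).comp
    (tendsto_id.const_mul_atTop hc)
  refine h.congr' ?_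
  filter_upwards [eventually_gt_atTop 0] with t ht
  have hev : u =ᶠ[𝓝 t] fun t => spectralLaplace β (c * t) := by
    filter_upwards [Ioi_mem_nhds ht] with s hs using hu' hs
  simp only [Function.comp, id]
  rw [hev.deriv_eq, deriv_comp_mul_left, hu' ht, smul_eq_mul]
  ring

end

theorem theorem4 (β r : ℝ) (hβ0 : 0 < β) (hβ1 : β < 1) (hr : r < 0) :
    IsCaputoSolution β r (fun t => mittagLeffler β (r * t ^ β)) ∧
    (∀ u : ℝ → ℝ, IsCaputoSolution β r u →
      (∀ t : ℝ, 0 ≤ t → u t = mittagLeffler β (r * t ^ β)) ∧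
      Tendsto (fun t => t * deriv u t / u t) atTop (𝓝 (-β))) ∧
    (fun x : ℝ => mittagLeffler β (-x)) ~[atTop] (fun x : ℝ => x⁻¹ / Real.Gamma (1 - β)) :=
  ⟨isCaputoSolution_mittagLeffler hβ0 hβ1 r,
    fun _ hu => ⟨fun _ ht => hu.unique hβ0 hβ1 (isCaputoSolution_mittagLeffler hβ0 hβ1 r) ht,
      hu.tendsto_mul_deriv_div hβ0 hβ1 hr⟩,
    mittagLeffler_neg_isEquivalent hβ0 hβ1⟩
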